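/- Conventions. Locally convex spaces are Hausdorff. A map $f:U\to Y$ from an open subset of a locally convex space $X$ to a locally convex space $Y$ is $C^1$ if it is continuous, all directional derivatives $df(x)(h)=\lim_{t\to 0}\frac1t(f(x+th)-f(x))$ exist and $df:U\times X\to Y$ is continuous; it is $C^n$ if it is $C^1$ and $df$ is $C^{n-1}$, and smooth if it is $C^n$ for all $n$. If $X,Y$ are complex, $f$ is (anti)holomorphic if it is smooth and all $df(x)$ are complex (conjugate) linear. Manifolds (Hausdorff), Lie groups and complex manifolds modeled on locally convex spaces are defined accordingly. An exponential function of a Lie group $G$ with Lie algebra $L(G)=T_1(G)$ is a smooth map $\exp_G:L(G)\to G$ such that, for every $x$, $t\mapsto\exp_G(tx)$ is a one-parameter group with velocity $x$ at $t=0$. An involutive complex semigroup $S$ is a complex manifold modeled on a locally convex space with a holomorphic associative multiplication and an antiholomorphic involutive antiautomorphism $s\mapsto s^*$. A multiplier of $S$ is a pair $m=(\lambda,\rho)$ of holomorphic maps $S\to S$ with $a\lambda(b)=\rho(a)b$, $\lambda(ab)=\lambda(a)b$, $\rho(ab)=a\rho(b)$; we write $ms:=\lambda(s)$. The multipliers form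 an involutive monoid $M(S)$ with $(\lambda,\rho)(\lambda',\rho')=(\lambda\circ\lambda',\rho'\circ\rho)$ and $(\lambda,\rho)^*=(\rho^*,\lambda^*)$, where $\lambda^*(a)=\lambda(a^*)^*$ and $\rho^*(a)=\rho(a^*)^*$. Its unitary group is $U(M(S))$, and $s\in S$ defines the multiplier $(\lambda_s,\rho_s)$ of left and right multiplication by $s$. Let $G$ be a connected Lie group with exponential function $\exp_G$. A host semigroup for $G$ is a triple $(S,\eta,W)$ of an involutive complex semigroup $S$ with an approximate identity (a net $(u_i)$ in $S$ with $u_is\to s$ and $su_i\to s$ for all $s\in S$), a homomorphism $\eta:G\to U(M(S))$, and an open convex $\mathrm{Ad}(G)$-invariant cone $W\subseteq L(G)$ such that: (1) the left action $G\times S\to S$, $(g,s)\mapsto gs:=\eta(g)s$, is smooth; (2) for each $x\in W$ the one-parameter group $t\mapsto\eta(\exp_G(tx))$ extends to a morphism $\hat\eta_x:\mathbb C_+=\mathbb R+i[0,\infty)\to M(S)$ of involutive semigroups (the involution of the additive semigroup $\mathbb C_+$ being $z\mapsto-\bar z$) defining a continuous left action of $\mathbb C_+$ on $S$, and on the open upper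 half plane $\mathbb C_+^0$ it is given by multipliers defined by elements $\gamma_x(z)\in S$, where $\gamma_x:\mathbb C_+^0\to S$ is holomorphic; (3) a holomorphic function $f:S\to\mathbb C$ with $f\circ\gamma_x=0$ for all $x\in W$ vanishes. An absolute value on $S$ is a function $\alpha:S\to[0,\infty)$ with $\alpha(s^*)=\alpha(s)$ and $\alpha(st)\le\alpha(s)\alpha(t)$; it is $G$-invariant if $\alpha(gs)=\alpha(s)$ for all $g\in G$, $s\in S$. The $C^*$-algebra $C^*(S,\alpha)$ is the Hausdorff completion of the semigroup algebra $\mathbb C[S]$, with involution $f^*(s)=\overline{f(s^*)}$, with respect to the $C^*$-seminorm $\|f\|=\sup_\beta\|\sum_s f(s)\beta(s)\|$, where $\beta$ runs over all holomorphic morphisms of involutive semigroups $\beta:S\to A$ into (the multiplicative semigroups of) $C^*$-algebras $A$ with $\|\beta(s)\|\le\alpha(s)$ for all $s\in S$; $\eta_\alpha(s)$ is the image of $\delta_s$. For a $C^*$-algebra $A$ with multiplier algebra $M(A)$, a homomorphism $\gamma:G\to U(M(A))$ is strictly smooth if the elements $a\in A$ for which both $g\mapsto\gamma(g)a$ and $g\mapsto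 a\gamma(g)$ are smooth are dense in $A$. The pair $(A,\gamma)$ is a host algebra for $G$ if, denoting by $\tilde\pi$ the unique extension to $M(A)$ of a non-degenerate representation $\pi$ of $A$ on a complex Hilbert space, the unitary representation $\tilde\pi\circ\gamma$ of $G$ is (strongly) continuous for every such $\pi$, and $\pi\mapsto\tilde\pi\circ\gamma$ is injective on the non-degenerate representations of $A$ on each complex Hilbert space. Proposition. Let $(S,\eta,W)$ be a host semigroup of the Lie group $G$ and $\alpha$ a $G$-invariant locally bounded absolute value on $S$. Then there is a unique homomorphism $\tilde\eta:G\to U(M(C^*(S,\alpha)))$ with $\tilde\eta(g)\eta_\alpha(s)=\eta_\alpha(gs)$ for all $g\in G$, $s\in S$. It is strictly smooth, and $(C^*(S,\alpha),\tilde\eta)$ is a host algebra for $G$. -/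

import Mathlib

open Set Filter Topology UniformSpace
open scoped MultiplierAlgebra

namespace HostAlg

universe u v w

/-! ### Differential calculus on locally convex spaces -/

section Calculus

/-- `v` is the derivative `df(x)(h) = lim_{t → 0} t⁻¹ (f (x + t h) - f x)`
of `f` at `x` in the direction `h`. -/
def HasDirDeriv {X Y : Type*} [AddCommGroup X] [Module ℝ X]
    [AddCommGroup Y] [Module ℝ Y] [TopologicalSpace Y] (f : X → Y) (x h : X) (v : Y) : Prop :=
  Tendsto (fun t : ℝ => t⁻¹ • (f (x + t • h) - f x)) (𝓝[≠] 0) (𝓝 v)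

/-- `f` is of class `C^n` on the (open) set `U`: `C^0` means continuous, and `C^(n+1)` means that
`f` is continuous, that all directional derivatives `df(x)(h)` with `x ∈ U` exist, and that
`df : U × X → Y` is of class `C^n`. -/
def CnOn {Y : Type v} [AddCommGroup Y] [Module ℝ Y] [TopologicalSpace Y] :
    ℕ → ∀ {X : Type u} [AddCommGroup X] [Module ℝ X] [TopologicalSpace X],
      (X → Y) → Set X → Prop
  | 0, _, _, _, _, f, U => ContinuousOn f U
  | n + 1, X, _, _, _, f, U => ContinuousOn f U ∧ ∃ df : X × X → Y,
      (∀ x ∈ U, ∀ h : X, HasDirDeriv f x h (df (x, h))) ∧ CnOn n df (U ×ˢ (univ : Set X))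

/-- `f` is smooth on the (open) set `U`. -/
def SmoothOn {X : Type u} {Y : Type v} [AddCommGroup X] [Module ℝ X] [TopologicalSpace X]
    [AddCommGroup Y] [Module ℝ Y] [TopologicalSpace Y] (f : X → Y) (U : Set X) : Prop :=
  ∀ n : ℕ, CnOn n f U

/-- `f` is holomorphic on the (open) set `U`: smooth with complex linear differentials. -/
def HolomorphicOn {X : Type u} {Y : Type v} [AddCommGroup X] [Module ℂ X] [TopologicalSpace X]
    [AddCommGroup Y] [Module ℂ Y] [TopologicalSpace Y] (f : X → Y) (U : Set X) : Prop :=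
  SmoothOn f U ∧ ∀ x ∈ U, ∃ L : X →ₗ[ℂ] Y, ∀ h : X, HasDirDeriv f x h (L h)

/-- `f` is antiholomorphic on the (open) set `U`: smooth with conjugate linear differentials. -/
def AntiholomorphicOn {X : Type u} {Y : Type v}
    [AddCommGroup X] [Module ℂ X] [TopologicalSpace X]
    [AddCommGroup Y] [Module ℂ Y] [TopologicalSpace Y] (f : X → Y) (U : Set X) : Prop :=
  SmoothOn f U ∧ ∀ x ∈ U, ∃ L : X →ₛₗ[starRingEnd ℂ] Y, ∀ h : X, HasDirDeriv f x h (L h)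

end Calculus

/-! ### Manifolds and Lie groups modelled on locally convex spaces -/

section Manifolds

instance instAddCommGroupModelProd (E F : Type*) [AddCommGroup E] [AddCommGroup F] :
    AddCommGroup (ModelProd E F) := inferInstanceAs (AddCommGroup (E × F))

instance instModuleModelProd (R E F : Type*) [Semiring R] [AddCommGroup E] [AddCommGroup F]
    [Module R E] [Module R F] : Module R (ModelProd E F) := inferInstanceAs (Module R (E × F))

/-- `f : M → N` is continuous, and all its expressions in charts of `M` and `N` have the
property `P` on their (open) domain. -/
def InCharts (E F : Type*) [TopologicalSpace E] [TopologicalSpace F]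
    (P : (E → F) → Set E → Prop) {M N : Type*} [TopologicalSpace M] [TopologicalSpace N]
    [ChartedSpace E M] [ChartedSpace F N] (f : M → N) : Prop :=
  Continuous f ∧ ∀ e ∈ atlas E M, ∀ e' ∈ atlas F N,
    P (fun x => e' (f (e.symm x))) (e.target ∩ e.symm ⁻¹' (f ⁻¹' e'.source))

/-- Smooth maps between manifolds modelled on `E` and `F`. -/
def SmoothMap (E F : Type*) [AddCommGroup E] [Module ℝ E] [TopologicalSpace E]
    [AddCommGroup F] [Module ℝ F] [TopologicalSpace F]
    {M N : Type*} [TopologicalSpace M] [TopologicalSpace N]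
    [ChartedSpace E M] [ChartedSpace F N] (f : M → N) : Prop :=
  InCharts E F SmoothOn f

/-- Holomorphic maps between complex manifolds modelled on `E` and `F`. -/
def HolomorphicMap (E F : Type*) [AddCommGroup E] [Module ℂ E] [TopologicalSpace E]
    [AddCommGroup F] [Module ℂ F] [TopologicalSpace F]
    {M N : Type*} [TopologicalSpace M] [TopologicalSpace N]
    [ChartedSpace E M] [ChartedSpace F N] (f : M → N) : Prop :=
  InCharts E F HolomorphicOn f

/-- Antiholomorphic maps between complex manifolds modelled on `E` and `F`. -/
def AntiholomorphicMap (E F : Type*) [AddCommGroup E] [Module ℂ E] [TopologicalSpace E]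
    [AddCommGroup F] [Module ℂ F] [TopologicalSpace F]
    {M N : Type*} [TopologicalSpace M] [TopologicalSpace N]
    [ChartedSpace E M] [ChartedSpace F N] (f : M → N) : Prop :=
  InCharts E F AntiholomorphicOn f

/-- `G` is a Lie group modelled on the locally convex space `E`: the coordinate changes
(the chart expressions of the identity), the multiplication and the inversion are smooth. -/
class IsLCLieGroup (E : Type*) [AddCommGroup E] [Module ℝ E] [TopologicalSpace E]
    (G : Type*) [Group G] [TopologicalSpace G] [ChartedSpace E G] : Prop where
  smooth_coordChange : SmoothMap E E (id : G → G)
  smooth_mul : SmoothMap (ModelProd E E) E (fun p : G × G => p.1 * p.2)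
  smooth_inv : SmoothMap E E (fun g : G => g⁻¹)

variable {E : Type*} [AddCommGroup E] [Module ℝ E] [TopologicalSpace E]
  {G : Type*} [Group G] [TopologicalSpace G] [ChartedSpace E G]

/-- The Lie algebra `L(G) = T_1(G)` is identified with `E` through the preferred chart at `1`.
`IsExpFunction expG` says that `expG : L(G) → G` is an exponential function of `G`: it is smooth,
and for each `x` the curve `t ↦ expG (t x)` is a one-parameter group with velocity `x` at `t = 0`. -/
structure IsExpFunction (expG : E → G) : Prop where
  smooth : SmoothMap E E expG
  add_smul : ∀ (x : E) (s t : ℝ), expG ((s + t) • x) = expG (s • x) * expG (t • x)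
  velocity : ∀ x : E, HasDirDeriv (fun t : ℝ => chartAt E (1 : G) (expG (t • x))) 0 1 x

/-- The adjoint action `Ad(g) : L(G) → L(G)`, the differential at `1` of `a ↦ g a g⁻¹`,
computed in the preferred chart at `1`. -/
noncomputable def Ad (g : G) (x : E) : E :=
  limUnder (𝓝[≠] (0 : ℝ)) (fun t : ℝ => t⁻¹ •
    (chartAt E (1 : G) (g * (chartAt E (1 : G)).symm (chartAt E (1 : G) 1 + t • x) * g⁻¹)
      - chartAt E (1 : G) 1))

end Manifolds

/-! ### Complex involutive semigroups, absolute values and multipliers -/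

section Semigroups

/-- `S` is a complex involutive semigroup modelled on the complex locally convex space `F`:
a complex manifold with a holomorphic multiplication and an antiholomorphic involution
(an antiautomorphism, by `StarMul`). -/
class IsComplexInvolutiveSemigroup (F : Type*) [AddCommGroup F] [Module ℂ F] [TopologicalSpace F]
    (S : Type*) [Semigroup S] [StarMul S] [TopologicalSpace S] [ChartedSpace F S] : Prop where
  holomorphic_coordChange : HolomorphicMap F F (id : S → S)
  holomorphic_mul : HolomorphicMap (ModelProd F F) F (fun p : S × S => p.1 * p.2)
  antiholomorphic_star : AntiholomorphicMap F F (fun s : S => star s)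

/-- An absolute value on an involutive semigroup. -/
structure AbsVal (S : Type*) [Semigroup S] [StarMul S] where
  /-- the underlying function -/
  toFun : S → ℝ
  nonneg : ∀ s, 0 ≤ toFun s
  map_star : ∀ s, toFun (star s) = toFun s
  map_mul_le : ∀ s t, toFun (s * t) ≤ toFun s * toFun t

instance (S : Type*) [Semigroup S] [StarMul S] : CoeFun (AbsVal S) (fun _ => S → ℝ) :=
  ⟨AbsVal.toFun⟩

/-- The absolute value is locally bounded. -/
def AbsVal.IsLocallyBounded {S : Type*} [Semigroup S] [StarMul S] [TopologicalSpace S]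
    (α : AbsVal S) : Prop :=
  ∀ s : S, ∃ U ∈ 𝓝 s, ∃ C : ℝ, ∀ t ∈ U, α t ≤ C

/-- A net `(u_i)` in `S`, given by its filter of tails, with `lim u_i s = lim s u_i = s`
exists. -/
def HasApproxIdentity (S : Type*) [Semigroup S] [TopologicalSpace S] : Prop :=
  ∃ l : Filter S, l.NeBot ∧
    ∀ s : S, Tendsto (fun u => u * s) l (𝓝 s) ∧ Tendsto (fun u => s * u) l (𝓝 s)

/-- A pair `(left, right)` of self-maps of `S` satisfying the algebraic conditions on a
multiplier. The set `M(S)` of multipliers of a complex involutive semigroup consists of those pairs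
whose components are holomorphic, see `Multiplier.IsHolomorphic`. -/
@[ext]
structure Multiplier (S : Type*) [Semigroup S] where
  /-- the map `λ : s ↦ m s` -/
  left : S → S
  /-- the map `ρ : s ↦ s m` -/
  right : S → S
  mul_left : ∀ a b, a * left b = right a * b
  left_mul : ∀ a b, left (a * b) = left a * b
  right_mul : ∀ a b, right (a * b) = a * right b

namespace Multiplier

variable {S : Type*} [Semigroup S]

instance : Mul (Multiplier S) where
  mul m n :=
    { left := fun s => m.left (n.left s)
      right := fun s => n.right (m.right s)
      mul_left := fun a b => by rw [m.mul_left, n.mul_left]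
      left_mul := fun a b => by rw [n.left_mul, m.left_mul]
      right_mul := fun a b => by rw [m.right_mul, n.right_mul] }

instance : One (Multiplier S) where
  one :=
    { left := id
      right := id
      mul_left := fun _ _ => rfl
      left_mul := fun _ _ => rfl
      right_mul := fun _ _ => rfl }

instance : Monoid (Multiplier S) where
  mul_assoc _ _ _ := rfl
  one_mul _ := rfl
  mul_one _ := rfl

instance [StarMul S] : Star (Multiplier S) where
  star m :=
    { left := fun s => star (m.right (star s))
      right := fun s => star (m.left (star s))
      mul_left := fun a b => by
        have h := congrArg star (m.mul_left (star b) (star a))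
        simpa using h.symm
      left_mul := fun a b => by simp [m.right_mul]
      right_mul := fun a b => by simp [m.left_mul] }

instance [StarMul S] : StarMul (Multiplier S) where
  star_involutive m := by
    ext s
    · change star (star (m.left (star (star s)))) = m.left s
      simp
    · change star (star (m.right (star (star s)))) = m.right s
      simp
  star_mul m n := by
    ext s
    · change star (n.right (m.right (star s))) = star (n.right (star (star (m.right (star s)))))
      simp
    · change star (m.left (n.left (star s))) = star (m.left (star (star (n.left (star s)))))
      simp

/-- The multiplier `(λ_a, ρ_a)` defined by an element `a` of `S`. -/
def ofElem (a : S) : Multiplier S where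
  left := fun s => a * s
  right := fun s => s * a
  mul_left := fun _ _ => (mul_assoc _ _ _).symm
  left_mul := fun _ _ => (mul_assoc _ _ _).symm
  right_mul := fun _ _ => mul_assoc _ _ _

/-- Both components of the multiplier are holomorphic. -/
def IsHolomorphic (F : Type*) [AddCommGroup F] [Module ℂ F] [TopologicalSpace F]
    [TopologicalSpace S] [ChartedSpace F S] (m : Multiplier S) : Prop :=
  HolomorphicMap F F m.left ∧ HolomorphicMap F F m.right

end Multiplier

end Semigroups

/-! ### Host semigroups -/

section HostSemigroups

/-- The closed upper half plane `ℂ₊ = ℝ + i [0, ∞)`, an additive semigroup; its involution is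
`z ↦ -conj z`. -/
abbrev ClosedHalfPlane : Type := {z : ℂ // 0 ≤ z.im}

/-- Addition in the closed upper half plane. -/
def ClosedHalfPlane.add (z z' : ClosedHalfPlane) : ClosedHalfPlane :=
  ⟨z.1 + z'.1, by simpa using add_nonneg z.2 z'.2⟩

/-- The involution `z ↦ -conj z` of the closed upper half plane. -/
def ClosedHalfPlane.invol (z : ClosedHalfPlane) : ClosedHalfPlane :=
  ⟨-(starRingEnd ℂ z.1), by simpa using z.2⟩

/-- A real number as an element of the closed upper half plane. -/
def ClosedHalfPlane.ofReal (t : ℝ) : ClosedHalfPlane := ⟨(t : ℂ), by simp⟩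

/-- A point of the open upper half plane as an element of the closed upper half plane. -/
def ClosedHalfPlane.ofOpen (z : UpperHalfPlane) : ClosedHalfPlane := ⟨(z : ℂ), z.im_pos.le⟩

variable {E : Type*} [AddCommGroup E] [Module ℝ E] [TopologicalSpace E]
  (F : Type*) [AddCommGroup F] [Module ℂ F] [TopologicalSpace F]
  {G : Type*} [Group G] [TopologicalSpace G] [ChartedSpace E G]
  {S : Type*} [Semigroup S] [StarMul S] [TopologicalSpace S] [ChartedSpace F S]

/-- `ηx : ℂ₊ → M(S)` is a morphism of involutive semigroups into the holomorphic multipliers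
of `S` which extends the one-parameter group `γ : ℝ → U(M(S))` and defines a continuous left action
of `ℂ₊` on `S`; it maps the open half plane into `S ⊆ M(S)`, and the corresponding map from the
open half plane to `S` is the holomorphic map `c`. -/
structure IsHalfPlaneExtension (γ : ℝ → unitary (Multiplier S))
    (ηx : ClosedHalfPlane → Multiplier S) (c : UpperHalfPlane → S) : Prop where
  isHolomorphic : ∀ z, (ηx z).IsHolomorphic F
  map_add : ∀ z z', ηx (z.add z') = ηx z * ηx z'
  map_invol : ∀ z, ηx z.invol = star (ηx z)
  map_real : ∀ t : ℝ, ηx (ClosedHalfPlane.ofReal t) = (γ t : Multiplier S)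
  continuous_action : Continuous (fun p : ClosedHalfPlane × S => (ηx p.1).left p.2)
  map_open : ∀ z : UpperHalfPlane, ηx (ClosedHalfPlane.ofOpen z) = Multiplier.ofElem (c z)
  holomorphic_open : HolomorphicMap ℂ F c

/-- `(S, η, W)` is a host semigroup for the Lie group `G` with exponential function `expG`.
The homomorphism `η` takes values in the unitary group of the algebraic multipliers, and
`isHolomorphic` says that its values are holomorphic, that is, `η : G → U(M(S))`. -/
structure IsHostSemigroup (expG : E → G) (η : G →* unitary (Multiplier S))
    (W : ConvexCone ℝ E) : Prop where
  approxIdentity : HasApproxIdentity S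
  isHolomorphic : ∀ g : G, (η g : Multiplier S).IsHolomorphic F
  isOpen_cone : IsOpen (W : Set E)
  ad_invariant : ∀ g : G, ∀ x ∈ W, Ad g x ∈ W
  /-- the left action of `G` on `S` is smooth -/
  smooth_action : SmoothMap (ModelProd E F) F
    (fun p : G × S => (η p.1 : Multiplier S).left p.2)
  /-- the one-parameter groups defined by `x ∈ W` extend to the closed upper half plane -/
  extension : ∀ x ∈ W, ∃ (ηx : ClosedHalfPlane → Multiplier S) (c : UpperHalfPlane → S),
    IsHalfPlaneExtension F (fun t : ℝ => η (expG (t • x))) ηx c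
  /-- a holomorphic function on `S` vanishing on all the curves `c : ℂ₊⁰ → S` defined by elements
  of `W` is zero; the extension `(ηx, c)` is determined by `x` -/
  determining : ∀ f : S → ℂ, HolomorphicMap F ℂ f →
    (∀ x ∈ W, ∀ (ηx : ClosedHalfPlane → Multiplier S) (c : UpperHalfPlane → S),
      IsHalfPlaneExtension F (fun t : ℝ => η (expG (t • x))) ηx c → ∀ z, f (c z) = 0) →
    f = 0

end HostSemigroups

set_option linter.unusedSectionVars false

/-! ### Completion of a *-algebra with a C*-seminorm -/

/-- The Hausdorff completion of a *-algebra `R` with a C*-seminorm. -/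
def CStarCompletion (R : Type*) [NonUnitalSeminormedRing R] : Type _ := Completion R

namespace CStarCompletion

section Ring

variable {R : Type*} [NonUnitalSeminormedRing R]

noncomputable instance : NormedAddCommGroup (CStarCompletion R) :=
  inferInstanceAs (NormedAddCommGroup (Completion R))

instance : CompleteSpace (CStarCompletion R) :=
  inferInstanceAs (CompleteSpace (Completion R))

/-- The canonical map of `R` to its completion. -/
noncomputable def of : R →+ CStarCompletion R := Completion.toCompl

lemma continuous_of : Continuous (of : R → CStarCompletion R) := Completion.continuous_coe _

lemma isDenseInducing_of : IsDenseInducing (of : R → CStarCompletion R) :=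
  Completion.isDenseInducing_coe

lemma norm_of (f : R) : ‖of f‖ = ‖f‖ := Completion.norm_coe f

@[elab_as_elim]
lemma induction_of {p : CStarCompletion R → Prop} (a : CStarCompletion R)
    (hp : IsClosed {a | p a}) (h : ∀ f, p (of f)) : p a :=
  Completion.induction_on a hp h

noncomputable instance : Mul (CStarCompletion R) :=
  ⟨Function.curry ((isDenseInducing_of.prodMap isDenseInducing_of).extend
    (of ∘ Function.uncurry ((· * ·) : R → R → R)))⟩

lemma of_mul (f g : R) : of (f * g) = of f * of g :=
  ((isDenseInducing_of.prodMap isDenseInducing_of).extend_eq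
    (continuous_of.comp (continuous_mul (M := R))) (f, g)).symm

instance : ContinuousMul (CStarCompletion R) where
  continuous_mul := by
    let m := (AddMonoidHom.mul : R →+ R →+ R).compr₂ of
    have hm : Continuous fun p : R × R => m p.1 p.2 := continuous_of.comp continuous_mul
    have di : IsDenseInducing (of : R →+ CStarCompletion R) := isDenseInducing_of
    exact (di.extend_Z_bilin di hm :)

lemma norm_mul_le_aux (a b : CStarCompletion R) : ‖a * b‖ ≤ ‖a‖ * ‖b‖ := by
  induction a using induction_of with
  | hp =>
    exact isClosed_le (continuous_norm.comp (continuous_id.mul continuous_const))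
      (continuous_norm.mul continuous_const)
  | h f =>
    induction b using induction_of with
    | hp =>
      exact isClosed_le (continuous_norm.comp (continuous_const.mul continuous_id))
        (continuous_const.mul continuous_norm)
    | h g =>
      rw [← of_mul, norm_of, norm_of, norm_of]
      exact norm_mul_le f g

lemma zero_mul_aux (a : CStarCompletion R) :
    0 * a = 0 := by
  refine induction_of a (isClosed_eq (by fun_prop) (by fun_prop)) fun f => ?_
  rw [← map_zero of, ← of_mul, zero_mul]

lemma mul_zero_aux (a : CStarCompletion R) :
    a * 0 = 0 := by
  refine induction_of a (isClosed_eq (by fun_prop) (by fun_prop)) fun f => ?_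
  rw [← map_zero of, ← of_mul, mul_zero]

lemma mul_add_aux (a b c : CStarCompletion R) :
    a * (b + c) = a * b + a * c := by
  refine induction_of a (isClosed_eq (by fun_prop) (by fun_prop)) fun f => ?_
  refine induction_of b (isClosed_eq (by fun_prop) (by fun_prop)) fun g => ?_
  refine induction_of c (isClosed_eq (by fun_prop) (by fun_prop)) fun h => ?_
  simp only [← map_add, ← of_mul, mul_add]

lemma add_mul_aux (a b c : CStarCompletion R) :
    (a + b) * c = a * c + b * c := by
  refine induction_of a (isClosed_eq (by fun_prop) (by fun_prop)) fun f => ?_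
  refine induction_of b (isClosed_eq (by fun_prop) (by fun_prop)) fun g => ?_
  refine induction_of c (isClosed_eq (by fun_prop) (by fun_prop)) fun h => ?_
  simp only [← map_add, ← of_mul, add_mul]

lemma mul_assoc_aux (a b c : CStarCompletion R) :
    a * b * c = a * (b * c) := by
  refine induction_of a (isClosed_eq
    ((continuous_id.mul continuous_const).mul continuous_const) (continuous_id.mul continuous_const)) fun f => ?_
  refine induction_of b (isClosed_eq
    ((continuous_const.mul continuous_id).mul continuous_const) (continuous_const.mul (continuous_id.mul continuous_const))) fun g => ?_
  refine induction_of c (isClosed_eq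
    (continuous_const.mul continuous_id) (continuous_const.mul (continuous_const.mul continuous_id))) fun h => ?_
  simp only [← of_mul, mul_assoc]

noncomputable instance : NonUnitalNormedRing (CStarCompletion R) :=
  { (inferInstance : NormedAddCommGroup (CStarCompletion R)),
    (inferInstance : Mul (CStarCompletion R)) with
    zero_mul := zero_mul_aux
    mul_zero := mul_zero_aux
    left_distrib := mul_add_aux
    right_distrib := add_mul_aux
    mul_assoc := mul_assoc_aux
    norm_mul_le := norm_mul_le_aux }

end Ring

section Star

variable {R : Type*} [NonUnitalSeminormedRing R] [StarRing R] [NormedStarGroup R]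

noncomputable instance : Star (CStarCompletion R) := ⟨Completion.map (star : R → R)⟩

lemma of_star (f : R) : of (star f) = star (of f) :=
  (Completion.map_coe
    (starNormedAddGroupHom : NormedAddGroupHom R R).uniformContinuous f).symm

instance : ContinuousStar (CStarCompletion R) where
  continuous_star := Completion.continuous_map

noncomputable instance : StarRing (CStarCompletion R) where
  star_involutive a := by
    refine induction_of a (isClosed_eq (by fun_prop) (by fun_prop)) fun f => ?_
    simp only [← of_star, star_star]
  star_mul a b := by
    refine induction_of a (isClosed_eq (by fun_prop) (by fun_prop)) fun f => ?_
    refine induction_of b (isClosed_eq (by fun_prop) (by fun_prop)) fun g => ?_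
    simp only [← of_star, ← of_mul, star_mul]
  star_add a b := by
    refine induction_of a (isClosed_eq (by fun_prop) (by fun_prop)) fun f => ?_
    refine induction_of b (isClosed_eq (by fun_prop) (by fun_prop)) fun g => ?_
    simp only [← of_star, ← map_add, star_add]

lemma norm_mul_self_le_aux (h : ∀ f : R, ‖f‖ * ‖f‖ ≤ ‖star f * f‖) (a : CStarCompletion R) :
    ‖a‖ * ‖a‖ ≤ ‖star a * a‖ := by
  induction a using induction_of with
  | hp =>
    exact isClosed_le (continuous_norm.mul continuous_norm)
      (continuous_norm.comp (continuous_star.mul continuous_id))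
  | h f =>
    rw [← of_star, ← of_mul, norm_of, norm_of]
    exact h f

variable [NormedSpace ℂ R]

noncomputable instance : NormedSpace ℂ (CStarCompletion R) :=
  inferInstanceAs (NormedSpace ℂ (Completion R))

lemma of_smul (c : ℂ) (f : R) : of (c • f) = c • of f := Completion.coe_smul c f

lemma smul_assoc_aux [IsScalarTower ℂ R R] (c : ℂ) (a b : CStarCompletion R) :
    (c • a) * b = c • (a * b) := by
  refine induction_of a (isClosed_eq
    ((continuous_id.const_smul c).mul continuous_const) ((continuous_id.mul continuous_const).const_smul c)) fun f => ?_
  refine induction_of b (isClosed_eq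
    (continuous_const.mul continuous_id) ((continuous_const.mul continuous_id).const_smul c)) fun g => ?_
  simp only [← of_smul, ← of_mul, smul_mul_assoc]

lemma smul_comm_aux [SMulCommClass ℂ R R] (c : ℂ) (a b : CStarCompletion R) :
    c • (a * b) = a * (c • b) := by
  refine induction_of a (isClosed_eq
    ((continuous_id.mul continuous_const).const_smul c) (continuous_id.mul continuous_const)) fun f => ?_
  refine induction_of b (isClosed_eq
    ((continuous_const.mul continuous_id).const_smul c) (continuous_const.mul (continuous_id.const_smul c))) fun g => ?_
  simp only [← of_smul, ← of_mul, mul_smul_comm]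

lemma star_smul_aux [StarModule ℂ R] (c : ℂ) (a : CStarCompletion R) :
    star (c • a) = star c • star a := by
  refine induction_of a (isClosed_eq
    (continuous_star.comp (continuous_id.const_smul c)) ((continuous_star.comp continuous_id).const_smul (star c))) fun f => ?_
  simp only [← of_smul, ← of_star, star_smul]

/-- The completion with respect to a C*-seminorm is a C*-algebra. -/
noncomputable abbrev nonUnitalCStarAlgebra [IsScalarTower ℂ R R] [SMulCommClass ℂ R R]
    [StarModule ℂ R] (h : ∀ f : R, ‖f‖ * ‖f‖ ≤ ‖star f * f‖) :
    NonUnitalCStarAlgebra (CStarCompletion R) :=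
  { (inferInstance : NonUnitalNormedRing (CStarCompletion R)),
    (inferInstance : StarRing (CStarCompletion R)),
    (inferInstance : CompleteSpace (CStarCompletion R)),
    (inferInstance : NormedSpace ℂ (CStarCompletion R)) with
    norm_mul_self_le := norm_mul_self_le_aux h
    smul_assoc := smul_assoc_aux
    smul_comm := smul_comm_aux
    star_smul := star_smul_aux }

end Star

end CStarCompletion

/-! ### The C*-algebra of a complex involutive semigroup with absolute value -/

section CStar

variable (F : Type*) [AddCommGroup F] [Module ℂ F] [TopologicalSpace F]
  {S : Type u} [Semigroup S] [StarMul S] [TopologicalSpace S] [ChartedSpace F S]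
  (α : AbsVal S)

/-- `β : S → A` is an `α`-bounded holomorphic morphism of involutive semigroups into the
multiplicative semigroup of the C*-algebra `A`. -/
structure IsBoundedHolomorphicMorphism {A : Type*} [NonUnitalCStarAlgebra A]
    (β : S →ₙ* A) : Prop where
  map_star : ∀ s, β (star s) = star (β s)
  holomorphic : HolomorphicMap F A β
  norm_le : ∀ s, ‖β s‖ ≤ α s

/-- The semigroup algebra `ℂ[S]`, to be endowed with the C*-seminorm
`f ↦ sup_β ‖∑ f(s) β(s)‖`, where `β` runs over the `α`-bounded holomorphic morphisms into
C*-algebras. (The closed subalgebra generated by `β(S)` has a copy in the universe of `S`, so that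
C*-algebras in this universe suffice.) -/
def SemigroupAlg (_F : Type*) (_α : AbsVal S) : Type u := MonoidAlgebra ℂ S

namespace SemigroupAlg

noncomputable instance : NonUnitalRing (SemigroupAlg F α) :=
  inferInstanceAs (NonUnitalRing (MonoidAlgebra ℂ S))

noncomputable instance : Module ℂ (SemigroupAlg F α) :=
  inferInstanceAs (Module ℂ (MonoidAlgebra ℂ S))

instance : IsScalarTower ℂ (SemigroupAlg F α) (SemigroupAlg F α) :=
  inferInstanceAs (IsScalarTower ℂ (MonoidAlgebra ℂ S) (MonoidAlgebra ℂ S))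

instance : SMulCommClass ℂ (SemigroupAlg F α) (SemigroupAlg F α) :=
  inferInstanceAs (SMulCommClass ℂ (MonoidAlgebra ℂ S) (MonoidAlgebra ℂ S))

/-- The element `c δ_s`. -/
noncomputable def single (s : S) (c : ℂ) : SemigroupAlg F α := MonoidAlgebra.single s c

/-- The linear extension `f ↦ ∑ f(s) β(s)` of a morphism `β`. -/
noncomputable def lift {A : Type*} [NonUnitalCStarAlgebra A] (β : S →ₙ* A) :
    SemigroupAlg F α →ₙₐ[ℂ] A := MonoidAlgebra.liftMagma ℂ β

/-- The involution `f^*(s) = conj (f (s^*))`, that is, `(c δ_s)^* = conj c δ_{s^*}`. -/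
noncomputable def starHom : SemigroupAlg F α →+ SemigroupAlg F α :=
  (MonoidAlgebra.coeffAddEquiv (R := ℂ) (M := S)).symm.toAddMonoidHom.comp
    ((Finsupp.mapDomain.addMonoidHom (fun s : S => star s)).comp
      ((Finsupp.mapRange.addMonoidHom (starRingEnd ℂ).toAddMonoidHom).comp
        (MonoidAlgebra.coeffAddEquiv (R := ℂ) (M := S)).toAddMonoidHom))

variable {F α}

@[elab_as_elim]
lemma induction_single {p : SemigroupAlg F α → Prop} (f : SemigroupAlg F α) (zero : p 0)
    (add : ∀ f g, p f → p g → p (f + g)) (hs : ∀ s c, p (single F α s c)) : p f :=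
  MonoidAlgebra.induction_linear (motive := p) f zero add hs

lemma starHom_single (s : S) (c : ℂ) :
    starHom F α (single F α s c) = single F α (star s) (starRingEnd ℂ c) := by
  apply MonoidAlgebra.coeff_injective
  change Finsupp.mapDomain _ (Finsupp.mapRange _ (map_zero _) (Finsupp.single s c)) =
    Finsupp.single _ _
  rw [Finsupp.mapRange_single, Finsupp.mapDomain_single]
  rfl

lemma single_mul_single (s t : S) (c d : ℂ) :
    single F α s c * single F α t d = single F α (s * t) (c * d) :=
  MonoidAlgebra.single_mul_single _ _ _ _

lemma lift_single {A : Type*} [NonUnitalCStarAlgebra A] (β : S →ₙ* A) (s : S) (c : ℂ) :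
    lift F α β (single F α s c) = c • β s := by
  change (Finsupp.single s c).sum _ = _
  simp [Finsupp.sum_single_index]

noncomputable instance : StarRing (SemigroupAlg F α) where
  star := starHom F α
  star_involutive f := by
    induction f using induction_single with
    | zero => simp
    | add f g hf hg => simp [hf, hg]
    | hs s c => simp [starHom_single]
  star_mul f g := by
    induction f using induction_single with
    | zero => simp
    | add f g hf hg => simp [hf, hg, add_mul, mul_add]
    | hs s c =>
      induction g using induction_single with
      | zero => simp
      | add f g hf hg => simp [hf, hg, add_mul, mul_add]
      | hs t d => simp [starHom_single, single_mul_single, mul_comm]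
  star_add f g := map_add (starHom F α) f g

lemma star_single (s : S) (c : ℂ) :
    star (single F α s c) = single F α (star s) (starRingEnd ℂ c) := starHom_single s c

lemma smul_single (a : ℂ) (s : S) (c : ℂ) :
    a • single F α s c = single F α s (a * c) := MonoidAlgebra.smul_single _ _ _

instance : StarModule ℂ (SemigroupAlg F α) where
  star_smul a f := by
    induction f using induction_single with
    | zero => simp
    | add f g hf hg => simp [hf, hg]
    | hs s c => simp [star_single, smul_single]

lemma lift_star {A : Type*} [NonUnitalCStarAlgebra A] {β : S →ₙ* A}
    (hβ : ∀ s, β (star s) = star (β s)) (f : SemigroupAlg F α) :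
    lift F α β (star f) = star (lift F α β f) := by
  induction f using induction_single with
  | zero => simp
  | add f g hf hg => simp [hf, hg]
  | hs s c => simp [star_single, lift_single, hβ]

variable (F α)

/-- The set of all norms `‖∑ f(s) β(s)‖`. -/
def normSet (f : SemigroupAlg F α) : Set ℝ :=
  {r | ∃ (A : Type u) (_ : NonUnitalCStarAlgebra A) (β : S →ₙ* A),
    IsBoundedHolomorphicMorphism F α β ∧ r = ‖lift F α β f‖}

/-- The C*-seminorm `sup_β ‖∑ f(s) β(s)‖` on `ℂ[S]`. -/
noncomputable def seminorm (f : SemigroupAlg F α) : ℝ := sSup (normSet F α f)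

variable {F α}

lemma normSet_bddAbove (f : SemigroupAlg F α) : BddAbove (normSet F α f) := by
  induction f using induction_single with
  | zero =>
    refine ⟨0, ?_⟩
    rintro r ⟨A, _, β, hβ, rfl⟩
    simp
  | add f g hf hg =>
    obtain ⟨a, ha⟩ := hf
    obtain ⟨b, hb⟩ := hg
    refine ⟨a + b, ?_⟩
    rintro r ⟨A, _, β, hβ, rfl⟩
    rw [map_add]
    exact (norm_add_le _ _).trans
      (add_le_add (ha ⟨A, _, β, hβ, rfl⟩) (hb ⟨A, _, β, hβ, rfl⟩))
  | hs s c =>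
    refine ⟨‖c‖ * α s, ?_⟩
    rintro r ⟨A, _, β, hβ, rfl⟩
    rw [lift_single, norm_smul]
    exact mul_le_mul_of_nonneg_left (hβ.norm_le s) (norm_nonneg c)

lemma norm_lift_le {A : Type u} [i : NonUnitalCStarAlgebra A] {β : S →ₙ* A}
    (hβ : IsBoundedHolomorphicMorphism F α β) (f : SemigroupAlg F α) :
    ‖lift F α β f‖ ≤ seminorm F α f :=
  le_csSup (normSet_bddAbove f) ⟨A, i, β, hβ, rfl⟩

lemma seminorm_nonneg (f : SemigroupAlg F α) : 0 ≤ seminorm F α f := by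
  apply Real.sSup_nonneg
  rintro r ⟨A, _, β, hβ, rfl⟩
  exact norm_nonneg _

lemma seminorm_le {f : SemigroupAlg F α} {C : ℝ} (hC : 0 ≤ C)
    (h : ∀ (A : Type u) [NonUnitalCStarAlgebra A] (β : S →ₙ* A),
      IsBoundedHolomorphicMorphism F α β → ‖lift F α β f‖ ≤ C) : seminorm F α f ≤ C := by
  apply Real.sSup_le _ hC
  rintro r ⟨A, _, β, hβ, rfl⟩
  exact h A β hβ

lemma seminorm_smul (c : ℂ) (f : SemigroupAlg F α) :
    seminorm F α (c • f) ≤ ‖c‖ * seminorm F α f := by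
  refine seminorm_le (mul_nonneg (norm_nonneg _) (seminorm_nonneg f)) fun A _ β hβ => ?_
  rw [map_smul, norm_smul]
  exact mul_le_mul_of_nonneg_left (norm_lift_le hβ f) (norm_nonneg _)

lemma seminorm_mul (f g : SemigroupAlg F α) :
    seminorm F α (f * g) ≤ seminorm F α f * seminorm F α g := by
  refine seminorm_le (mul_nonneg (seminorm_nonneg f) (seminorm_nonneg g)) fun A _ β hβ => ?_
  rw [map_mul]
  exact (norm_mul_le _ _).trans (mul_le_mul (norm_lift_le hβ f) (norm_lift_le hβ g)
    (norm_nonneg _) (seminorm_nonneg f))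

lemma seminorm_cstar (f : SemigroupAlg F α) :
    seminorm F α f * seminorm F α f ≤ seminorm F α (star f * f) := by
  have h : seminorm F α f ≤ Real.sqrt (seminorm F α (star f * f)) := by
    refine seminorm_le (Real.sqrt_nonneg _) fun A _ β hβ => ?_
    apply Real.le_sqrt_of_sq_le
    have := norm_lift_le hβ (star f * f)
    rwa [map_mul, lift_star hβ.map_star, CStarRing.norm_star_mul_self, ← sq] at this
  calc _ ≤ Real.sqrt (seminorm F α (star f * f)) * Real.sqrt (seminorm F α (star f * f)) :=
        mul_le_mul h h (seminorm_nonneg f) (Real.sqrt_nonneg _)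
    _ = _ := Real.mul_self_sqrt (seminorm_nonneg _)

lemma seminorm_star_le (f : SemigroupAlg F α) : seminorm F α (star f) ≤ seminorm F α f := by
  refine seminorm_le (seminorm_nonneg f) fun A _ β hβ => ?_
  rw [lift_star hβ.map_star, norm_star]
  exact norm_lift_le hβ f

variable (F α)

/-- The seminorm as a seminorm on the additive group of `ℂ[S]`. -/
noncomputable def groupSeminorm : AddGroupSeminorm (SemigroupAlg F α) where
  toFun := seminorm F α
  map_zero' := le_antisymm
    (seminorm_le le_rfl fun A _ β _ => by simp) (seminorm_nonneg _)
  add_le' f g := by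
    refine seminorm_le (add_nonneg (seminorm_nonneg f) (seminorm_nonneg g)) fun A _ β hβ => ?_
    rw [map_add]
    exact (norm_add_le _ _).trans (add_le_add (norm_lift_le hβ f) (norm_lift_le hβ g))
  neg' f := by
    have : normSet F α (-f) = normSet F α f := by
      ext r
      simp only [normSet, map_neg, norm_neg]
    change sSup _ = sSup _
    rw [this]

noncomputable instance : SeminormedAddCommGroup (SemigroupAlg F α) :=
  (groupSeminorm F α).toSeminormedAddCommGroup

noncomputable instance : NonUnitalSeminormedRing (SemigroupAlg F α) :=
  { (inferInstance : SeminormedAddCommGroup (SemigroupAlg F α)),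
    (inferInstance : NonUnitalRing (SemigroupAlg F α)) with
    norm_mul_le := seminorm_mul }

noncomputable instance : NormedSpace ℂ (SemigroupAlg F α) where
  norm_smul_le := seminorm_smul

instance : NormedStarGroup (SemigroupAlg F α) where
  norm_star_le := seminorm_star_le

end SemigroupAlg

/-- The C*-algebra `C^*(S, α)`: the Hausdorff completion of `ℂ[S]` with respect to the C*-seminorm
`f ↦ sup_β ‖∑ f(s) β(s)‖`. As this seminorm is bounded by `∑ |f(s)| α(s)`, completing `ℂ[S]`
to `ℓ¹(S, α)` first leads to the same algebra. -/
def HostCStar (F : Type*) [AddCommGroup F] [Module ℂ F] [TopologicalSpace F]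
    {S : Type u} [Semigroup S] [StarMul S] [TopologicalSpace S] [ChartedSpace F S]
    (α : AbsVal S) : Type u :=
  CStarCompletion (SemigroupAlg F α)

namespace HostCStar

noncomputable instance : NonUnitalCStarAlgebra (HostCStar F α) :=
  CStarCompletion.nonUnitalCStarAlgebra (R := SemigroupAlg F α) SemigroupAlg.seminorm_cstar

/-- The canonical map `η_α : S → C^*(S, α)`. -/
noncomputable def eta (s : S) : HostCStar F α :=
  CStarCompletion.of (SemigroupAlg.single F α s 1)

end HostCStar

end CStar

/-! ### Strictly smooth homomorphisms and host algebras -/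

section HostAlgebras

variable {G : Type*} [Group G] [TopologicalSpace G] {A : Type*} [NonUnitalCStarAlgebra A]

/-- `a ∈ A` is a smooth vector for the left and the right action of `G` on `A` defined by
`γ : G → U(M(A))`, that is, the orbit maps `g ↦ γ(g) a` and `g ↦ a γ(g)` are smooth. -/
def IsSmoothVector (E : Type*) [AddCommGroup E] [Module ℝ E] [TopologicalSpace E]
    [ChartedSpace E G] (γ : G →* unitary 𝓜(ℂ, A)) (a : A) : Prop :=
  SmoothMap E A (fun g : G => (γ g : 𝓜(ℂ, A)).fst a) ∧
    SmoothMap E A (fun g : G => (γ g : 𝓜(ℂ, A)).snd a)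

/-- `γ : G → U(M(A))` is strictly smooth: the smooth vectors are dense in `A`. -/
def IsStrictlySmooth (E : Type*) [AddCommGroup E] [Module ℝ E] [TopologicalSpace E]
    [ChartedSpace E G] (γ : G →* unitary 𝓜(ℂ, A)) : Prop :=
  Dense {a : A | IsSmoothVector E γ a}

section Representations

variable {H : Type*} [NormedAddCommGroup H] [InnerProductSpace ℂ H] [CompleteSpace H]

/-- The representation `π` of `A` on `H` is non-degenerate. -/
def IsNondegenerate (π : A →⋆ₙₐ[ℂ] (H →L[ℂ] H)) : Prop :=
  ∀ v : H, (∀ a : A, π a v = 0) → v = 0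

/-- `ρ` is the extension of the representation `π` of `A` to the multiplier algebra `M(A)`
(it exists and is unique if `π` is non-degenerate). -/
def IsMultiplierExtension (π : A →⋆ₙₐ[ℂ] (H →L[ℂ] H)) (ρ : 𝓜(ℂ, A) →⋆ₐ[ℂ] (H →L[ℂ] H)) : Prop :=
  ∀ a : A, ρ (DoubleCentralizer.coe ℂ a) = π a

end Representations

/-- `(A, γ)` is a host algebra for the topological group `G`. -/
structure IsHostAlgebra (γ : G →* unitary 𝓜(ℂ, A)) : Prop where
  /-- every non-degenerate representation of `A` extends to `M(A)`, and the resulting unitary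
  representation of `G` is (strongly) continuous. -/
  continuous_rep : ∀ (H : Type w) [NormedAddCommGroup H] [InnerProductSpace ℂ H] [CompleteSpace H]
    (π : A →⋆ₙₐ[ℂ] (H →L[ℂ] H)), IsNondegenerate π →
      (∃ ρ : 𝓜(ℂ, A) →⋆ₐ[ℂ] (H →L[ℂ] H), IsMultiplierExtension π ρ) ∧
      ∀ ρ : 𝓜(ℂ, A) →⋆ₐ[ℂ] (H →L[ℂ] H), IsMultiplierExtension π ρ →
        ∀ v : H, Continuous (fun g : G => ρ (γ g : 𝓜(ℂ, A)) v)
  /-- a non-degenerate representation of `A` is determined by the resulting representation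
  of `G`. -/
  injective_rep : ∀ (H : Type w) [NormedAddCommGroup H] [InnerProductSpace ℂ H] [CompleteSpace H]
    (π₁ π₂ : A →⋆ₙₐ[ℂ] (H →L[ℂ] H)) (ρ₁ ρ₂ : 𝓜(ℂ, A) →⋆ₐ[ℂ] (H →L[ℂ] H)),
      IsNondegenerate π₁ → IsNondegenerate π₂ →
      IsMultiplierExtension π₁ ρ₁ → IsMultiplierExtension π₂ ρ₂ →
      (∀ g : G, ρ₁ (γ g : 𝓜(ℂ, A)) = ρ₂ (γ g : 𝓜(ℂ, A))) → π₁ = π₂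

end HostAlgebras

end HostAlg

/-!
Write `A = C^*(S, α)` and let `η_α : S → A` be the canonical map, whose values span a dense subspace.

*The homomorphism.* For a unitary multiplier `m` of `S` one has `(m s)^* (m t) = s^* t`. Hence the
linear map `δ_s ↦ δ_{m s}` of `ℂ[S]` preserves the products `f^* f`, and the C*-identity makes it
isometric (`HostCStar.norm_leftLinear`). It extends to `A`, and together with its counterpart from
the right it is a multiplier of `A` (`HostCStar.toMultiplier`). A multiplier of a C*-algebra is
determined by its left component, so that the values on `η_α(S)` determine the homomorphism
(`HostCStar.multiplier_ext`).

*Smoothness.* The map `η_α` is holomorphic (`HostCStar.holomorphicMap_eta`). Indeed, on complex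
lines in a chart the `α`-bounded holomorphic morphisms `β` are locally bounded uniformly in `β`, and
the Schwarz lemma makes their difference quotients converge at a rate independent of `β`. Since the
norm of `A` is the supremum over all `β`, the map `η_α` is continuous and complex differentiable
along complex lines, and maps of this kind into Banach spaces are holomorphic
(`IsGateauxOn.holomorphicOn`). Composing `η_α` with the smooth action of `G` on `S`, one sees that
all `η_α(s)`, and hence the elements of their dense span, are smooth vectors
(`IsHostSemigroup.isSmoothVector_eta`). The chain rule is only needed for outer maps with values in
normed spaces, where it follows from the mean value inequality (`CnOn.comp`).

*Representations.* A non-degenerate representation `π` of `A` extends to the multipliers by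
`ρ(m) π(a) v = π(m a) v`; an approximate unit of `A` shows that this is well defined and bounded by
the norm of `m` (`IsNondegenerate.exists_extension`). Strong continuity on `G` follows from the
density of the smooth vectors. Let `π₁`, `π₂` induce the same representation of `G`, and
let `x ∈ W`. For `v₁ = π₁(η_α(s)) v` and `w₂ = π₂(η_α(t)) w`, the two functions
`z ↦ ⟪w₂, π_j(η_α(γ_x(z))) v₁⟫` are holomorphic on the open upper half plane and extend continuously
to the closed one: for `j = 1` the semigroup acts on `s`, for `j = 2` its adjoint acts on `t`. On the
real axis both are given by the representation of `G`, so they coincide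
(`eq_zero_of_boundary_zero`, `rep_eq_on_halfPlane`). Therefore the matrix coefficients of `π₁ ∘ η_α`
and `π₂ ∘ η_α` differ by a holomorphic function on `S` which vanishes on all `γ_x`, and this
function is zero because `(S, η, W)` is a host semigroup (`IsHostSemigroup.rep_injective`).
-/

open scoped InnerProductSpace

namespace HostAlg

/-! ### Calculus of directional derivatives -/

section Calculus

variable {X Y : Type*} [AddCommGroup X] [Module ℝ X]
  [AddCommGroup Y] [Module ℝ Y] [TopologicalSpace Y]

lemma HasDirDeriv.unique [T2Space Y] {f : X → Y} {x h : X} {v w : Y}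
    (hv : HasDirDeriv f x h v) (hw : HasDirDeriv f x h w) : v = w :=
  tendsto_nhds_unique hv hw

lemma hasDirDeriv_iff_hasDerivAt {B : Type*} [NormedAddCommGroup B] [NormedSpace ℝ B]
    {f : X → B} {x h : X} {v : B} :
    HasDirDeriv f x h v ↔ HasDerivAt (fun t : ℝ => f (x + t • h)) v 0 := by
  rw [hasDerivAt_iff_tendsto_slope_zero]
  simp [HasDirDeriv]

/-- The directional derivative `(x, h) ↦ df(x)(h)` as a total function, with an arbitrary value where
the limit does not exist. -/
noncomputable def dirDeriv (f : X → Y) (p : X × X) : Y :=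
  limUnder (𝓝[≠] (0 : ℝ)) fun t : ℝ => t⁻¹ • (f (p.1 + t • p.2) - f p.1)

lemma HasDirDeriv.dirDeriv_eq [T2Space Y] {f : X → Y} {x h : X} {v : Y}
    (hf : HasDirDeriv f x h v) : dirDeriv f (x, h) = v :=
  Tendsto.limUnder_eq hf

variable [TopologicalSpace X]

lemma tendsto_add_smul [ContinuousAdd X] [ContinuousSMul ℝ X] (x h : X) :
    Tendsto (fun t : ℝ => x + t • h) (𝓝 0) (𝓝 x) := by
  have : Continuous fun t : ℝ => x + t • h := by fun_prop
  simpa using this.tendsto 0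

lemma HasDirDeriv.congr_of_eqOn [ContinuousAdd X] [ContinuousSMul ℝ X] {f g : X → Y} {U : Set X}
    (hU : IsOpen U) (hfg : EqOn f g U) {x h : X} {v : Y} (hx : x ∈ U) (hf : HasDirDeriv f x h v) :
    HasDirDeriv g x h v := by
  refine Tendsto.congr' ?_ hf
  have := (tendsto_add_smul x h).eventually (hU.mem_nhds hx)
  filter_upwards [this.filter_mono nhdsWithin_le_nhds] with t ht
  rw [hfg ht, hfg hx]

lemma CnOn.continuousOn {n : ℕ} {f : X → Y} {U : Set X} (hf : CnOn n f U) : ContinuousOn f U := by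
  cases n with
  | zero => exact hf
  | succ n => exact hf.1

end Calculus

section CnOn

universe a b c

variable {Y : Type b} [AddCommGroup Y] [Module ℝ Y] [TopologicalSpace Y]

lemma CnOn.mono {n : ℕ} {X : Type a} [AddCommGroup X] [Module ℝ X] [TopologicalSpace X]
    {f : X → Y} {U V : Set X} (hf : CnOn n f U) (hVU : V ⊆ U) : CnOn n f V := by
  induction n generalizing X with
  | zero => exact ContinuousOn.mono hf hVU
  | succ n ih =>
    obtain ⟨hc, df, hd, hdf⟩ := hf
    exact ⟨hc.mono hVU, df, fun x hx => hd x (hVU hx), ih hdf (prod_mono hVU Subset.rfl)⟩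

lemma CnOn.congr {n : ℕ} {X : Type a} [AddCommGroup X] [Module ℝ X] [TopologicalSpace X]
    [ContinuousAdd X] [ContinuousSMul ℝ X] {f g : X → Y} {U : Set X} (hU : IsOpen U)
    (hf : CnOn n f U) (hfg : EqOn f g U) : CnOn n g U := by
  cases n with
  | zero => exact ContinuousOn.congr hf hfg.symm
  | succ n =>
    obtain ⟨hc, df, hd, hdf⟩ := hf
    exact ⟨hc.congr hfg.symm, df, fun x hx h => (hd x hx h).congr_of_eqOn hU hfg hx, hdf⟩

lemma CnOn.of_succ {n : ℕ} {X : Type a} [AddCommGroup X] [Module ℝ X] [TopologicalSpace X]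
    {f : X → Y} {U : Set X} (hf : CnOn (n + 1) f U) : CnOn n f U := by
  induction n generalizing X with
  | zero => exact hf.1
  | succ n ih =>
    obtain ⟨hc, df, hd, hdf⟩ := hf
    exact ⟨hc, df, hd, ih hdf⟩

/-- The derivative in the definition of `C^(n+1)` may be taken to be `dirDeriv f`. -/
lemma CnOn.succ_dirDeriv [T2Space Y] {n : ℕ} {X : Type a} [AddCommGroup X] [Module ℝ X]
    [TopologicalSpace X] [ContinuousAdd X] [ContinuousSMul ℝ X] {f : X → Y} {U : Set X}
    (hU : IsOpen U) (hf : CnOn (n + 1) f U) :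
    (∀ x ∈ U, ∀ h : X, HasDirDeriv f x h (dirDeriv f (x, h))) ∧
      CnOn n (dirDeriv f) (U ×ˢ (univ : Set X)) := by
  obtain ⟨-, df, hd, hdf⟩ := hf
  have he : ∀ x ∈ U, ∀ h, df (x, h) = dirDeriv f (x, h) := fun x hx h =>
    (hd x hx h).dirDeriv_eq.symm
  refine ⟨fun x hx h => he x hx h ▸ hd x hx h, hdf.congr (hU.prod isOpen_univ) ?_⟩
  rintro ⟨x, h⟩ hx
  exact he x hx.1 h

/-- Being of class `C^n` is a local property. -/
lemma CnOn.of_local [T2Space Y] {n : ℕ} {X : Type a} [AddCommGroup X] [Module ℝ X]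
    [TopologicalSpace X] [ContinuousAdd X] [ContinuousSMul ℝ X] {f : X → Y} {U : Set X}
    (hf : ∀ x ∈ U, ∃ V, IsOpen V ∧ x ∈ V ∧ CnOn n f V) : CnOn n f U := by
  induction n generalizing X with
  | zero =>
    intro x hx
    obtain ⟨V, hV, hxV, h⟩ := hf x hx
    exact (ContinuousOn.continuousAt h (hV.mem_nhds hxV)).continuousWithinAt
  | succ n ih =>
    refine ⟨?_, dirDeriv f, ?_, ih ?_⟩
    · intro x hx
      obtain ⟨V, hV, hxV, h⟩ := hf x hx
      exact (h.continuousOn.continuousAt (hV.mem_nhds hxV)).continuousWithinAt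
    · intro x hx
      obtain ⟨V, hV, hxV, h⟩ := hf x hx
      exact (h.succ_dirDeriv hV).1 x hxV
    · rintro ⟨x, h⟩ hx
      obtain ⟨V, hV, hxV, hV'⟩ := hf x hx.1
      exact ⟨V ×ˢ univ, hV.prod isOpen_univ, ⟨hxV, mem_univ _⟩, (hV'.succ_dirDeriv hV).2⟩

/-- Precomposition with a continuous affine map `A` with linear part `L`. -/
lemma CnOn.comp_affine {n : ℕ} {X : Type a} [AddCommGroup X] [Module ℝ X] [TopologicalSpace X]
    {X' : Type c} [AddCommGroup X'] [Module ℝ X'] [TopologicalSpace X']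
    {f : X → Y} {U : Set X} (hf : CnOn n f U) {A L : X' → X} (hA : Continuous A)
    (hL : Continuous L) (hAL : ∀ (t : ℝ) x h, A (x + t • h) = A x + t • L h)
    (hLL : ∀ (t : ℝ) x h, L (x + t • h) = L x + t • L h) :
    CnOn n (fun x => f (A x)) (A ⁻¹' U) := by
  induction n generalizing X X' with
  | zero => exact ContinuousOn.comp hf hA.continuousOn (mapsTo_preimage _ _)
  | succ n ih =>
    obtain ⟨hc, df, hd, hdf⟩ := hf
    refine ⟨hc.comp hA.continuousOn (mapsTo_preimage _ _), fun p => df (A p.1, L p.2),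
      fun x hx h => ?_, ?_⟩
    · have := hd (A x) hx (L h)
      unfold HasDirDeriv at this ⊢
      simpa only [hAL] using this
    · have := ih (X' := X' × X') hdf (A := Prod.map A L) (L := Prod.map L L)
        (hA.prodMap hL) (hL.prodMap hL) (fun t x h => Prod.ext (hAL t _ _) (hLL t _ _))
        (fun t x h => Prod.ext (hLL t _ _) (hLL t _ _))
      exact this.mono fun p hp => ⟨hp.1, mem_univ _⟩

/-- Postcomposition with a continuous real linear map. -/
lemma CnOn.linear_comp {Y' : Type c} [AddCommGroup Y'] [Module ℝ Y'] [TopologicalSpace Y']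
    {n : ℕ} {X : Type a} [AddCommGroup X] [Module ℝ X] [TopologicalSpace X]
    {f : X → Y} {U : Set X} (hf : CnOn n f U) (L : Y →L[ℝ] Y') : CnOn n (fun x => L (f x)) U := by
  induction n generalizing X with
  | zero => exact L.continuous.comp_continuousOn hf
  | succ n ih =>
    obtain ⟨hc, df, hd, hdf⟩ := hf
    refine ⟨L.continuous.comp_continuousOn hc, fun p => L (df p), fun x hx h => ?_, ih hdf⟩
    have := (L.continuous.tendsto _).comp (hd x hx h)
    simpa only [HasDirDeriv, Function.comp_def, map_smul, map_sub] using this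

lemma CnOn.prodMk {Y' : Type c} [AddCommGroup Y'] [Module ℝ Y'] [TopologicalSpace Y']
    {n : ℕ} {X : Type a} [AddCommGroup X] [Module ℝ X] [TopologicalSpace X]
    {f : X → Y} {g : X → Y'} {U : Set X} (hf : CnOn n f U) (hg : CnOn n g U) :
    CnOn n (fun x => (f x, g x)) U := by
  induction n generalizing X with
  | zero => exact ContinuousOn.prodMk hf hg
  | succ n ih =>
    obtain ⟨hc, df, hd, hdf⟩ := hf
    obtain ⟨gc, dg, gd, hdg⟩ := hg
    exact ⟨hc.prodMk gc, fun p => (df p, dg p), fun x hx h => (hd x hx h).prodMk_nhds (gd x hx h),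
      ih hdf hdg⟩

lemma cnOn_const {n : ℕ} {X : Type a} [AddCommGroup X] [Module ℝ X]
    [TopologicalSpace X] (v : Y) (U : Set X) : CnOn n (fun _ : X => v) U := by
  induction n generalizing X v with
  | zero => exact continuousOn_const
  | succ n ih =>
    refine ⟨continuousOn_const, fun _ => 0, fun x hx h => ?_, ih 0 _⟩
    simp [HasDirDeriv, tendsto_const_nhds]

end CnOn

section Chain

variable {X : Type*} [AddCommGroup X] [Module ℝ X] [TopologicalSpace X]
  [IsTopologicalAddGroup X] [ContinuousSMul ℝ X] {B : Type*} [NormedAddCommGroup B] [NormedSpace ℝ B]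

/-- Continuously differentiable maps into normed spaces are strictly differentiable: the mean value
inequality makes the convergence of the difference quotients locally uniform in the base point
and in the direction. -/
lemma tendsto_strict_dirDeriv {f : X → B} {df : X × X → B} {U : Set X} (hU : IsOpen U)
    (hd : ∀ x ∈ U, ∀ h : X, HasDirDeriv f x h (df (x, h)))
    (hdf : ContinuousOn df (U ×ˢ (univ : Set X))) {x : X} (hx : x ∈ U) (h : X) :
    Tendsto (fun q : ℝ × X × X => q.1⁻¹ • (f (q.2.1 + q.1 • q.2.2) - f q.2.1))
      (𝓝[≠] 0 ×ˢ 𝓝 (x, h)) (𝓝 (df (x, h))) := by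
  rw [Metric.tendsto_nhds]
  intro ε hε
  have hcont : Continuous fun q : ℝ × X × X => ((q.2.1 + q.1 • q.2.2, q.2.2) : X × X) := by
    fun_prop
  have hev : ∀ᶠ p in 𝓝 (x, h), p.1 ∈ U ∧ dist (df p) (df (x, h)) < ε / 2 := by
    have h1 : U ×ˢ (univ : Set X) ∈ 𝓝 (x, h) := (hU.prod isOpen_univ).mem_nhds ⟨hx, mem_univ _⟩
    have h2 := (hdf.continuousAt h1).tendsto
    rw [Metric.tendsto_nhds] at h2
    filter_upwards [h1, h2 (ε / 2) (half_pos hε)] with p hp hp'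
    exact ⟨hp.1, hp'⟩
  have hev' := (hcont.tendsto' (0, x, h) (x, h) (by simp)).eventually hev
  rw [nhds_prod_eq, eventually_prod_iff] at hev'
  obtain ⟨pa, ha, pb, hb, hab⟩ := hev'
  obtain ⟨δ, hδ, hball⟩ := Metric.eventually_nhds_iff_ball.1 ha
  have ha' : ∀ᶠ t : ℝ in 𝓝[≠] 0, t ∈ Metric.ball (0 : ℝ) δ ∧ t ≠ 0 := by
    refine Eventually.and ?_ eventually_mem_nhdsWithin
    exact mem_nhdsWithin_of_mem_nhds (Metric.ball_mem_nhds _ hδ)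
  filter_upwards [ha'.prod_mk hb] with ⟨t, y, k⟩ ⟨⟨ht, ht0⟩, hyk⟩
  simp only at ht ht0 hyk ⊢
  -- the mean value inequality for `s ↦ f (y + s k) - s df(x)(h)`
  have hder : ∀ s ∈ Metric.ball (0 : ℝ) δ,
      HasDerivWithinAt (fun s : ℝ => f (y + s • k) - s • df (x, h))
        (df (y + s • k, k) - df (x, h)) (Metric.ball 0 δ) s := by
    intro s hs
    have h1 := hab (hball s hs) hyk
    have h2 := (hasDirDeriv_iff_hasDerivAt.1 (hd _ h1.1 k))
    have h3 : HasDerivAt (fun s : ℝ => f (y + s • k)) (df (y + s • k, k)) s := by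
      rw [← sub_self s] at h2
      have := h2.comp_sub_const s s
      refine this.congr_of_eventuallyEq (Eventually.of_forall fun r => ?_)
      simp only
      congr 1
      module
    have h4 : HasDerivAt (fun s : ℝ => s • df (x, h)) (df (x, h)) s := by
      simpa using (hasDerivAt_id s).smul_const (df (x, h))
    exact (h3.sub h4).hasDerivWithinAt
  have hmvt := (convex_ball (0 : ℝ) δ).norm_image_sub_le_of_norm_hasDerivWithin_le hder
    (fun s hs => by
      have h1 := hab (hball s hs) hyk
      rw [← dist_eq_norm]; exact h1.2.le) (Metric.mem_ball_self hδ) ht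
  simp only [zero_smul, add_zero, sub_zero] at hmvt
  have he : t⁻¹ • (f (y + t • k) - f y) - df (x, h)
      = t⁻¹ • (f (y + t • k) - t • df (x, h) - f y) := by
    rw [sub_right_comm, smul_sub t⁻¹ _ (t • _), inv_smul_smul₀ ht0]
  rw [dist_eq_norm, he, norm_smul, norm_inv]
  calc ‖t‖⁻¹ * _ ≤ ‖t‖⁻¹ * (ε / 2 * ‖t‖) := by gcongr
    _ = ε / 2 := by field_simp [norm_ne_zero_iff.2 ht0]
    _ < ε := half_lt_self hε

/-- The chain rule for an outer `C^1` map into a normed space. -/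
lemma HasDirDeriv.comp_strict {f : X → B} {df : X × X → B} {U : Set X} (hU : IsOpen U)
    (hd : ∀ x ∈ U, ∀ h : X, HasDirDeriv f x h (df (x, h)))
    (hdf : ContinuousOn df (U ×ˢ (univ : Set X)))
    {X' : Type*} [AddCommGroup X'] [Module ℝ X'] {g : X' → X} {x k : X'} {v : X}
    (hx : g x ∈ U) (hg : HasDirDeriv g x k v) :
    HasDirDeriv (fun y => f (g y)) x k (df (g x, v)) := by
  have h1 : Tendsto (fun t : ℝ => (t, g x, t⁻¹ • (g (x + t • k) - g x))) (𝓝[≠] 0)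
      (𝓝[≠] 0 ×ˢ 𝓝 (g x, v)) :=
    tendsto_id.prodMk (tendsto_const_nhds.prodMk_nhds hg)
  refine ((tendsto_strict_dirDeriv hU hd hdf hx v).comp h1).congr' ?_
  filter_upwards [eventually_mem_nhdsWithin] with t ht
  simp only [Function.comp]
  rw [smul_inv_smul₀ ht, add_sub_cancel]

/-- Additivity of the differential of a `C^1` map into a normed space. -/
lemma differential_add {f : X → B} {df : X × X → B} {U : Set X} (hU : IsOpen U)
    (hd : ∀ x ∈ U, ∀ h : X, HasDirDeriv f x h (df (x, h)))
    (hdf : ContinuousOn df (U ×ˢ (univ : Set X))) {x : X} (hx : x ∈ U) (h k : X) :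
    df (x, h + k) = df (x, h) + df (x, k) := by
  have h1 : Tendsto (fun t : ℝ => (t, x + t • h, k)) (𝓝[≠] 0) (𝓝[≠] 0 ×ˢ 𝓝 (x, k)) :=
    tendsto_id.prodMk (((tendsto_add_smul x h).mono_left nhdsWithin_le_nhds).prodMk_nhds
      tendsto_const_nhds)
  refine (hd x hx (h + k)).unique ?_
  refine ((hd x hx h).add ((tendsto_strict_dirDeriv hU hd hdf hx k).comp h1)).congr fun t => ?_
  simp only [Function.comp]
  rw [← smul_add, smul_add t h k, add_assoc]
  congr 1
  abel

universe a b c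

/-- The chain rule for `C^n` maps with an outer map into a normed space. -/
lemma CnOn.comp {B : Type b} [NormedAddCommGroup B] [NormedSpace ℝ B] {n : ℕ}
    {X : Type a} [AddCommGroup X] [Module ℝ X] [TopologicalSpace X]
    [IsTopologicalAddGroup X] [ContinuousSMul ℝ X]
    {X' : Type c} [AddCommGroup X'] [Module ℝ X'] [TopologicalSpace X']
    {f : X → B} {U : Set X} {g : X' → X} {V : Set X'} (hU : IsOpen U)
    (hf : CnOn n f U) (hg : CnOn n g V) (hgV : MapsTo g V U) :
    CnOn n (fun x => f (g x)) V := by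
  induction n generalizing X X' with
  | zero => exact ContinuousOn.comp hf hg hgV
  | succ n ih =>
    have hg' := hg.of_succ
    obtain ⟨hc, df, hd, hdf⟩ := hf
    obtain ⟨gc, dg, gd, hdg⟩ := hg
    refine ⟨hc.comp gc hgV, fun p => df (g p.1, dg p),
      fun x hx h => (gd x hx h).comp_strict hU hd hdf.continuousOn (hgV hx), ?_⟩
    refine ih (hU.prod isOpen_univ) hdf (CnOn.prodMk ?_ hdg) fun p hp => ⟨hgV hp.1, mem_univ _⟩
    exact (hg'.comp_affine continuous_fst continuous_fst (fun _ _ _ => rfl)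
      (fun _ _ _ => rfl)).mono fun p hp => hp.1

end Chain

/-! ### Holomorphic maps into Banach spaces -/

section Schwarz

variable {B : Type*} [NormedAddCommGroup B] [NormedSpace ℂ B] {f : ℂ → B} {r C : ℝ}

/-- A bounded holomorphic function on a disc is Lipschitz at the centre, by the Schwarz lemma. -/
lemma norm_sub_le_of_bounded (hf : DifferentiableOn ℂ f (Metric.ball 0 r))
    (hC : ∀ z ∈ Metric.ball (0 : ℂ) r, ‖f z‖ ≤ C) {t : ℂ} (ht : t ∈ Metric.ball (0 : ℂ) r) :
    ‖f t - f 0‖ ≤ (C + C) / r * ‖t‖ := by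
  have hr : 0 < r := Metric.pos_of_mem_ball ht
  have := Complex.dist_le_div_mul_dist_of_mapsTo_ball (R₂ := C + C) hf (fun z hz => by
    rw [Metric.mem_closedBall, dist_eq_norm]
    exact (norm_sub_le _ _).trans (add_le_add (hC z hz) (hC 0 (Metric.mem_ball_self hr)))) ht
  simpa [dist_eq_norm] using this

/-- The difference quotients of a bounded holomorphic function on a disc converge at a rate which
depends only on the bound and on the radius. -/
lemma norm_dslope_sub_le_of_bounded [CompleteSpace B]
    (hf : DifferentiableOn ℂ f (Metric.ball 0 r))
    (hC : ∀ z ∈ Metric.ball (0 : ℂ) r, ‖f z‖ ≤ C) {t : ℂ} (ht : t ∈ Metric.ball (0 : ℂ) r) :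
    ‖dslope f 0 t - deriv f 0‖ ≤ ((C + C) / r + (C + C) / r) / r * ‖t‖ := by
  have hr : 0 < r := Metric.pos_of_mem_ball ht
  rw [← dslope_same f 0]
  refine norm_sub_le_of_bounded
    ((Complex.differentiableOn_dslope (Metric.ball_mem_nhds 0 hr)).2 hf) (fun z hz => ?_) ht
  refine Complex.norm_dslope_le_div_of_mapsTo_ball hf (fun z hz => ?_) hz
  rw [Metric.mem_closedBall, dist_eq_norm]
  exact (norm_sub_le _ _).trans (add_le_add (hC z hz) (hC 0 (Metric.mem_ball_self hr)))

end Schwarz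

section Gateaux

variable {X : Type*} [AddCommGroup X] [Module ℂ X] {B : Type*} [NormedAddCommGroup B]
  [NormedSpace ℂ B]

/-- `f` is Gateaux holomorphic on `U`: it is complex differentiable along all complex lines. -/
def IsGateauxOn (f : X → B) (U : Set X) : Prop :=
  ∀ x ∈ U, ∀ h : X, DifferentiableAt ℂ (fun z : ℂ => f (x + z • h)) 0

/-- The Gateaux differential `(x, h) ↦ df(x)(h)`. -/
noncomputable def gateauxDeriv (f : X → B) (p : X × X) : B :=
  deriv (fun z : ℂ => f (p.1 + z • p.2)) 0

lemma IsGateauxOn.differentiableAt {f : X → B} {U : Set X} (hf : IsGateauxOn f U) {x h : X} {z : ℂ}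
    (hz : x + z • h ∈ U) : DifferentiableAt ℂ (fun z : ℂ => f (x + z • h)) z := by
  have h1 : DifferentiableAt ℂ (fun w : ℂ => f (x + z • h + w • h)) (z - z) := by
    simpa only [sub_self] using hf _ hz h
  have h2 := DifferentiableAt.comp z (f := fun w : ℂ => w - z) h1
    (differentiableAt_id.sub_const z)
  refine h2.congr_of_eventuallyEq (Eventually.of_forall fun w => ?_)
  simp only [Function.comp]
  congr 1
  module

lemma gateauxDeriv_smul (f : X → B) (x h : X) (c : ℂ) :
    gateauxDeriv f (x, c • h) = c • gateauxDeriv f (x, h) := by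
  have := deriv_comp_mul_left c (fun z : ℂ => f (x + z • h)) 0
  simp only [mul_zero] at this
  unfold gateauxDeriv
  rw [← this]
  congr 1
  ext z
  simp only [smul_smul, mul_comm]

lemma IsGateauxOn.hasDirDeriv [Module ℝ X] [IsScalarTower ℝ ℂ X] {f : X → B} {U : Set X}
    (hf : IsGateauxOn f U) {x : X} (hx : x ∈ U) (h : X) :
    HasDirDeriv f x h (gateauxDeriv f (x, h)) := by
  rw [hasDirDeriv_iff_hasDerivAt]
  have h1 : HasDerivAt (fun z : ℂ => f (x + z • h)) (gateauxDeriv f (x, h)) ((0 : ℝ) : ℂ) := by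
    rw [Complex.ofReal_zero]
    exact (hf x hx h).hasDerivAt
  have h2 := h1.scomp (0 : ℝ) Complex.ofRealCLM.hasDerivAt
  simp only [Complex.ofRealCLM_apply, Complex.ofReal_one, one_smul] at h2
  refine h2.congr_of_eventuallyEq (Eventually.of_forall fun t => ?_)
  simp only [Function.comp]
  rw [← algebraMap_smul ℂ t h]
  rfl

variable [TopologicalSpace X] [IsTopologicalAddGroup X] [ContinuousSMul ℂ X]

/-- The difference quotients of a continuous Gateaux holomorphic map converge locally uniformly in the
base point and in the direction. Its Gateaux differential therefore inherits continuity and Gateaux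
holomorphy. -/
lemma IsGateauxOn.tendstoUniformlyOn [CompleteSpace B] {f : X → B} {U : Set X} (hU : IsOpen U)
    (hf : IsGateauxOn f U) (hc : ContinuousOn f U) {p : X × X} (hp : p.1 ∈ U) :
    ∃ N : Set (X × X), IsOpen N ∧ p ∈ N ∧ (∀ q ∈ N, q.1 ∈ U) ∧
      (∀ᶠ t : ℂ in 𝓝[≠] 0, ∀ q ∈ N, q.1 + t • q.2 ∈ U) ∧
      TendstoUniformlyOn (fun (t : ℂ) (q : X × X) => t⁻¹ • (f (q.1 + t • q.2) - f q.1))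
        (gateauxDeriv f) (𝓝[≠] 0) N := by
  have hcont : Continuous fun q : ℂ × X × X => q.2.1 + q.1 • q.2.2 := by fun_prop
  have hev : ∀ᶠ y in 𝓝 p.1, y ∈ U ∧ ‖f y‖ ≤ ‖f p.1‖ + 1 := by
    have h1 := hU.mem_nhds hp
    have h2 := (hc.continuousAt h1).norm.eventually_le_const (lt_add_one ‖f p.1‖)
    filter_upwards [h1, h2] with y hy hy'
    exact ⟨hy, hy'⟩
  have hev' := (hcont.tendsto' (0, p) p.1 (by simp)).eventually hev
  rw [nhds_prod_eq, eventually_prod_iff] at hev'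
  obtain ⟨pa, ha, pb, hb, hab⟩ := hev'
  obtain ⟨r, hr, hball⟩ := Metric.eventually_nhds_iff_ball.1 ha
  obtain ⟨N, hNb, hN, hpN⟩ := eventually_nhds_iff.1 hb
  have hdiff : ∀ q ∈ N, DifferentiableOn ℂ (fun z : ℂ => f (q.1 + z • q.2)) (Metric.ball 0 r) :=
    fun q hq z hz => (hf.differentiableAt (hab (hball z hz) (hNb q hq)).1).differentiableWithinAt
  have hsmall : ∀ᶠ t : ℂ in 𝓝[≠] 0, t ∈ Metric.ball (0 : ℂ) r :=
    mem_nhdsWithin_of_mem_nhds (Metric.ball_mem_nhds _ hr)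
  refine ⟨N, hN, hpN, fun q hq => ?_, ?_, ?_⟩
  · simpa using (hab (hball 0 (Metric.mem_ball_self hr)) (hNb q hq)).1
  · filter_upwards [hsmall] with t ht q hq
    exact (hab (hball t ht) (hNb q hq)).1
  · rw [Metric.tendstoUniformlyOn_iff]
    intro ε hε
    set C := ‖f p.1‖ + 1
    have hlim : Tendsto (fun t : ℂ => ((C + C) / r + (C + C) / r) / r * ‖t‖) (𝓝[≠] 0) (𝓝 0) := by
      have : Continuous fun t : ℂ => ((C + C) / r + (C + C) / r) / r * ‖t‖ := by fun_prop
      exact (this.tendsto' 0 0 (by simp)).mono_left nhdsWithin_le_nhds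
    filter_upwards [hsmall, hlim.eventually_lt_const hε, eventually_mem_nhdsWithin]
      with t ht htε ht0 q hq
    have := norm_dslope_sub_le_of_bounded (hdiff q hq)
      (fun z hz => (hab (hball z hz) (hNb q hq)).2) ht
    rw [dslope_of_ne _ ht0, slope_def_module, sub_zero] at this
    rw [dist_comm, dist_eq_norm]
    simp only [zero_smul, add_zero] at this
    exact this.trans_lt htε

lemma IsGateauxOn.continuousOn_gateauxDeriv [CompleteSpace B] {f : X → B} {U : Set X}
    (hU : IsOpen U) (hf : IsGateauxOn f U) (hc : ContinuousOn f U) :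
    ContinuousOn (gateauxDeriv f) (U ×ˢ (univ : Set X)) := by
  rintro p hp
  obtain ⟨N, hN, hpN, hNU, hev, hlim⟩ := hf.tendstoUniformlyOn hU hc hp.1
  refine ContinuousAt.continuousWithinAt (ContinuousOn.continuousAt ?_ (hN.mem_nhds hpN))
  refine hlim.continuousOn (Eventually.frequently ?_)
  filter_upwards [hev] with t ht
  have h1 : Continuous fun q : X × X => q.1 + t • q.2 := by fun_prop
  exact ((hc.comp h1.continuousOn ht).sub (hc.comp continuous_fst.continuousOn hNU)).const_smul _

lemma IsGateauxOn.gateauxDeriv [CompleteSpace B] {f : X → B} {U : Set X}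
    (hU : IsOpen U) (hf : IsGateauxOn f U) (hc : ContinuousOn f U) :
    IsGateauxOn (gateauxDeriv f) (U ×ˢ (univ : Set X)) := by
  rintro p hp q
  obtain ⟨N, hN, hpN, hNU, hev, hlim⟩ := hf.tendstoUniformlyOn hU hc hp.1
  have hline : Continuous fun w : ℂ => p + w • q := by fun_prop
  have hO : IsOpen ((fun w : ℂ => p + w • q) ⁻¹' N) := hN.preimage hline
  have h0 : (0 : ℂ) ∈ (fun w : ℂ => p + w • q) ⁻¹' N := by simpa using hpN
  refine DifferentiableOn.differentiableAt ?_ (hO.mem_nhds h0)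
  refine (hlim.comp fun w : ℂ => p + w • q).tendstoLocallyUniformlyOn.differentiableOn ?_ hO
  filter_upwards [hev] with t ht w hw
  refine DifferentiableAt.differentiableWithinAt (DifferentiableAt.const_smul ?_ t⁻¹)
  have h1 : (p.1 + t • p.2) + w • (q.1 + t • q.2) ∈ U := by
    convert ht _ hw using 1
    simp only [Prod.fst_add, Prod.smul_fst, Prod.snd_add, Prod.smul_snd]
    module
  have h2 := (hf.differentiableAt h1).sub (hf.differentiableAt (h := q.1) (hNU _ hw))
  refine h2.congr_of_eventuallyEq (Eventually.of_forall fun v => ?_)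
  simp only [Prod.fst_add, Prod.smul_fst, Prod.snd_add, Prod.smul_snd]
  congr 2
  module

end Gateaux

section Holomorphic

universe a b

lemma IsGateauxOn.cnOn {B : Type b} [NormedAddCommGroup B] [NormedSpace ℂ B] [CompleteSpace B]
    {n : ℕ} {X : Type a} [AddCommGroup X] [Module ℂ X] [Module ℝ X] [IsScalarTower ℝ ℂ X]
    [TopologicalSpace X] [IsTopologicalAddGroup X] [ContinuousSMul ℂ X] {f : X → B} {U : Set X}
    (hU : IsOpen U) (hf : IsGateauxOn f U) (hc : ContinuousOn f U) : CnOn n f U := by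
  induction n generalizing X with
  | zero => exact hc
  | succ n ih =>
    exact ⟨hc, HostAlg.gateauxDeriv f, fun x hx h => hf.hasDirDeriv hx h,
      ih (hU.prod isOpen_univ) (hf.gateauxDeriv hU hc) (hf.continuousOn_gateauxDeriv hU hc)⟩

lemma continuousSMul_real_of_complex (X : Type*) [AddCommGroup X] [Module ℂ X]
    [TopologicalSpace X] [ContinuousSMul ℂ X] : ContinuousSMul ℝ X where
  continuous_smul := by
    have : Continuous fun p : ℝ × X => (p.1 : ℂ) • p.2 := by fun_prop
    exact this

variable {X : Type*} [AddCommGroup X] [Module ℂ X] [TopologicalSpace X] [IsTopologicalAddGroup X]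
  [ContinuousSMul ℂ X] {B : Type*} [NormedAddCommGroup B] [NormedSpace ℂ B]

/-- Continuous Gateaux holomorphic maps into Banach spaces are holomorphic. -/
theorem IsGateauxOn.holomorphicOn [CompleteSpace B] {f : X → B} {U : Set X} (hU : IsOpen U)
    (hf : IsGateauxOn f U) (hc : ContinuousOn f U) : HolomorphicOn f U := by
  have := continuousSMul_real_of_complex X
  refine ⟨fun n => hf.cnOn hU hc, fun x hx =>
    ⟨{ toFun := fun h => HostAlg.gateauxDeriv f (x, h)
       map_add' := fun h k => ?_
       map_smul' := fun c h => gateauxDeriv_smul f x h c }, fun h => hf.hasDirDeriv hx h⟩⟩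
  exact differential_add hU (fun x hx h => hf.hasDirDeriv hx h)
    (hf.continuousOn_gateauxDeriv hU hc) hx h k

/-- Holomorphic maps are complex differentiable along complex lines. -/
theorem HolomorphicOn.isGateauxOn {f : X → B} {U : Set X} (hU : IsOpen U)
    (hf : HolomorphicOn f U) : IsGateauxOn f U := by
  have := continuousSMul_real_of_complex X
  obtain ⟨hs, hL⟩ := hf
  obtain ⟨-, df, hd, hdf⟩ := hs 1
  have hsmul : ∀ x ∈ U, ∀ (c : ℂ) (h : X), df (x, c • h) = c • df (x, h) := by
    intro x hx c h
    obtain ⟨L, hL⟩ := hL x hx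
    rw [(hd x hx (c • h)).unique (hL _), (hd x hx h).unique (hL _), map_smul]
  intro x hx h
  refine HasDerivAt.differentiableAt (f' := df (x, h)) ?_
  rw [hasDerivAt_iff_isLittleO_nhds_zero, Asymptotics.isLittleO_iff]
  intro ε hε
  have hline : Continuous fun w : ℂ => ((x + w • h, h) : X × X) := by fun_prop
  have hev : ∀ᶠ w : ℂ in 𝓝 0, x + w • h ∈ U ∧ ‖df (x + w • h, h) - df (x, h)‖ ≤ ε := by
    have h1 : U ×ˢ (univ : Set X) ∈ 𝓝 (x, h) := (hU.prod isOpen_univ).mem_nhds ⟨hx, mem_univ _⟩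
    have h2 := (hdf.continuousOn.continuousAt h1).tendsto
    rw [Metric.tendsto_nhds] at h2
    filter_upwards [(hline.tendsto' 0 (x, h) (by simp)).eventually h1,
      (hline.tendsto' 0 (x, h) (by simp)).eventually (h2 ε hε)] with w hw hw'
    exact ⟨hw.1, by rw [← dist_eq_norm]; exact hw'.le⟩
  obtain ⟨δ, hδ, hball⟩ := Metric.eventually_nhds_iff_ball.1 hev
  filter_upwards [Metric.ball_mem_nhds (0 : ℂ) hδ] with z hz
  -- the mean value inequality along the segment from `0` to `z`
  have hmem : ∀ s ∈ Icc (0 : ℝ) 1, (s • z : ℂ) ∈ Metric.ball (0 : ℂ) δ := fun s hs =>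
    (convex_ball (0 : ℂ) δ).smul_mem_of_zero_mem (Metric.mem_ball_self hδ) hz hs
  have hder : ∀ s ∈ Icc (0 : ℝ) 1,
      HasDerivWithinAt (fun s : ℝ => f (x + (s • z) • h) - s • z • df (x, h))
        (z • (df (x + (s • z) • h, h) - df (x, h))) (Icc 0 1) s := by
    intro s hs
    have h1 := (hball _ (hmem s hs)).1
    have h2 := hasDirDeriv_iff_hasDerivAt.1 (hd _ h1 (z • h))
    rw [← sub_self s, hsmul _ h1] at h2
    have h3 : HasDerivAt (fun s : ℝ => f (x + (s • z) • h)) (z • df (x + (s • z) • h, h)) s := by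
      refine (h2.comp_sub_const s s).congr_of_eventuallyEq (Eventually.of_forall fun r => ?_)
      simp only
      congr 1
      rw [smul_assoc, smul_assoc]
      module
    have h4 : HasDerivAt (fun s : ℝ => s • z • df (x, h)) (z • df (x, h)) s := by
      simpa using (hasDerivAt_id s).smul_const (z • df (x, h))
    rw [smul_sub]
    exact (h3.sub h4).hasDerivWithinAt
  have hmvt := norm_image_sub_le_of_norm_deriv_le_segment_01' hder (C := ε * ‖z‖) (fun s hs => by
    rw [norm_smul, mul_comm]
    exact mul_le_mul_of_nonneg_right (hball _ (hmem s ⟨hs.1, hs.2.le⟩)).2 (norm_nonneg _))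
  simp only [one_smul, zero_smul, add_zero, sub_zero] at hmvt
  rw [sub_right_comm] at hmvt
  simpa using hmvt

end Holomorphic

/-! ### Maps from manifolds into Banach spaces -/

section Manifolds

lemma inCharts_model_iff {E B : Type*} [TopologicalSpace E] [TopologicalSpace B]
    {P : (E → B) → Set E → Prop} {M : Type*} [TopologicalSpace M] [ChartedSpace E M] {f : M → B} :
    InCharts E B P f ↔ Continuous f ∧ ∀ e ∈ atlas E M, P (fun x => f (e.symm x)) e.target := by
  simp [InCharts]

/-- Maps with good chart expressions can be composed, if chart expressions can be composed and the
property of the chart expressions of the composition is local. -/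
lemma InCharts.comp {E F B : Type*} [TopologicalSpace E] [TopologicalSpace F] [TopologicalSpace B]
    {P : (E → F) → Set E → Prop} {Q : (F → B) → Set F → Prop} {R : (E → B) → Set E → Prop}
    (hcomp : ∀ (f : E → F) (g : F → B) U V, IsOpen V → P f U → Q g V → MapsTo f U V →
      R (fun x => g (f x)) U)
    (hcongr : ∀ (f g : E → B) U, IsOpen U → R f U → EqOn f g U → R g U)
    (hlocal : ∀ (f : E → B) U, (∀ x ∈ U, ∃ V, IsOpen V ∧ x ∈ V ∧ R f V) → R f U)
    {M N : Type*} [TopologicalSpace M] [TopologicalSpace N] [ChartedSpace E M] [ChartedSpace F N]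
    {f : M → N} {g : N → B} (hf : InCharts E F P f) (hg : InCharts F B Q g) :
    InCharts E B R (fun x => g (f x)) := by
  rw [inCharts_model_iff] at hg ⊢
  refine ⟨hg.1.comp hf.1, fun e he => hlocal _ _ fun x hx => ?_⟩
  set e₁ := chartAt F (f (e.symm x))
  have hopen : IsOpen (e.target ∩ e.symm ⁻¹' (f ⁻¹' e₁.source)) :=
    e.isOpen_inter_preimage_symm (e₁.open_source.preimage hf.1)
  refine ⟨e.target ∩ e.symm ⁻¹' (f ⁻¹' e₁.source), hopen, ⟨hx, mem_chart_source _ _⟩, ?_⟩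
  refine hcongr _ _ _ hopen (hcomp _ _ _ _ e₁.open_target (hf.2 e he e₁ (chart_mem_atlas _ _))
    (hg.2 e₁ (chart_mem_atlas _ _)) fun y hy => e₁.map_source hy.2) fun y hy => ?_
  rw [e₁.left_inv hy.2]

/-- Postcomposition with a continuous map. -/
lemma InCharts.postcomp {E B B' : Type*} [TopologicalSpace E] [TopologicalSpace B]
    [TopologicalSpace B'] {P : (E → B) → Set E → Prop} {Q : (E → B') → Set E → Prop} {L : B → B'}
    (hL : Continuous L) (hPQ : ∀ f U, P f U → Q (fun x => L (f x)) U)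
    {M : Type*} [TopologicalSpace M] [ChartedSpace E M] {f : M → B} (hf : InCharts E B P f) :
    InCharts E B' Q (fun x => L (f x)) := by
  rw [inCharts_model_iff] at hf ⊢
  exact ⟨hL.comp hf.1, fun e he => hPQ _ _ (hf.2 e he)⟩

section Smooth

variable {E : Type*} [AddCommGroup E] [Module ℝ E] [TopologicalSpace E]
  {M : Type*} [TopologicalSpace M] [ChartedSpace E M]
  {B : Type*} [NormedAddCommGroup B] [NormedSpace ℝ B]

lemma SmoothMap.comp [IsTopologicalAddGroup E] [ContinuousSMul ℝ E]
    {F : Type*} [AddCommGroup F] [Module ℝ F] [TopologicalSpace F]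
    [IsTopologicalAddGroup F] [ContinuousSMul ℝ F] {N : Type*} [TopologicalSpace N]
    [ChartedSpace F N] {g : N → B} {f : M → N} (hg : SmoothMap F B g) (hf : SmoothMap E F f) :
    SmoothMap E B (fun x => g (f x)) :=
  InCharts.comp (fun _ _ _ _ hV hf hg hUV n => (hg n).comp hV (hf n) hUV)
    (fun _ _ _ hU hf hfg n => (hf n).congr hU hfg)
    (fun _ _ h n => CnOn.of_local fun x hx =>
      let ⟨V, hV, hxV, h⟩ := h x hx
      ⟨V, hV, hxV, h n⟩) hf hg

lemma SmoothMap.linear_comp {B' : Type*} [NormedAddCommGroup B'] [NormedSpace ℝ B'] {f : M → B}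
    (hf : SmoothMap E B f) (L : B →L[ℝ] B') : SmoothMap E B' (fun x => L (f x)) :=
  InCharts.postcomp L.continuous (fun _ _ hf n => (hf n).linear_comp L) hf

lemma SmoothMap.add {f g : M → B} (hf : SmoothMap E B f) (hg : SmoothMap E B g) :
    SmoothMap E B (fun x => f x + g x) := by
  unfold SmoothMap at hf hg ⊢
  rw [inCharts_model_iff] at hf hg ⊢
  exact ⟨hf.1.add hg.1, fun e he n => ((hf.2 e he n).prodMk (hg.2 e he n)).linear_comp
    (ContinuousLinearMap.fst ℝ B B + ContinuousLinearMap.snd ℝ B B)⟩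

lemma smoothMap_zero : SmoothMap E B (fun _ : M => (0 : B)) := by
  unfold SmoothMap
  rw [inCharts_model_iff]
  exact ⟨continuous_const, fun e he n => cnOn_const _ _⟩

/-- The partial maps of a smooth map on a product are smooth. -/
lemma SmoothMap.partial_left {F F' : Type*} [AddCommGroup F] [Module ℝ F] [TopologicalSpace F]
    [AddCommGroup F'] [Module ℝ F'] [TopologicalSpace F']
    {N N' : Type*} [TopologicalSpace N] [ChartedSpace F N] [TopologicalSpace N'] [ChartedSpace F' N']
    {f : M × N → N'} (hf : SmoothMap (ModelProd E F) F' f) (y : N) :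
    SmoothMap E F' (fun x => f (x, y)) := by
  refine ⟨hf.1.comp (by fun_prop), fun e he e' he' n => ?_⟩
  have h := hf.2 (e.prod (chartAt F y)) (mem_image2_of_mem he (chart_mem_atlas F y)) e' he' n
  have h' : CnOn n (fun x => e' (f (e.symm x, (chartAt F y).symm (chartAt F y y)))) _ :=
    h.comp_affine (X' := E) (A := fun x => ((x, chartAt F y y) : E × F))
    (L := fun h => ((h, 0) : E × F)) (continuous_id.prodMk continuous_const)
    (continuous_id.prodMk continuous_const)
    (fun t x h => Prod.ext rfl (show _ = _ + t • (0 : F) by simp))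
    (fun t x h => Prod.ext rfl (show (0 : F) = 0 + t • (0 : F) by simp))
  have hy : (chartAt F y).symm (chartAt F y y) = y := (chartAt F y).left_inv (mem_chart_source F y)
  simp only [hy] at h'
  refine h'.mono fun x hx => ⟨⟨hx.1, mem_chart_target F y⟩, ?_⟩
  change f (e.symm x, (chartAt F y).symm (chartAt F y y)) ∈ e'.source
  rw [hy]
  exact hx.2

end Smooth

section Holomorphic

variable {X Y B B' : Type*} [AddCommGroup X] [Module ℂ X] [TopologicalSpace X]
  [AddCommGroup Y] [Module ℂ Y] [TopologicalSpace Y] [IsTopologicalAddGroup Y] [ContinuousSMul ℂ Y]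
  [NormedAddCommGroup B] [NormedSpace ℂ B] [NormedAddCommGroup B'] [NormedSpace ℂ B']

lemma HolomorphicOn.comp {f : X → Y} {g : Y → B} {U : Set X} {V : Set Y} (hV : IsOpen V)
    (hg : HolomorphicOn g V) (hf : HolomorphicOn f U) (hUV : MapsTo f U V) :
    HolomorphicOn (fun x => g (f x)) U := by
  have := continuousSMul_real_of_complex Y
  refine ⟨fun n => (hg.1 n).comp hV (hf.1 n) hUV, fun x hx => ?_⟩
  obtain ⟨L, hL⟩ := hf.2 x hx
  obtain ⟨L', hL'⟩ := hg.2 (f x) (hUV hx)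
  obtain ⟨-, dg, hd, hdg⟩ := hg.1 1
  refine ⟨L'.comp L, fun h => ?_⟩
  have h1 := HasDirDeriv.comp_strict hV hd hdg.continuousOn (hUV hx) (hL h)
  rwa [(hd _ (hUV hx) (L h)).unique (hL' _)] at h1

lemma HolomorphicOn.linear_comp {f : X → B} {U : Set X} (hf : HolomorphicOn f U) (L : B →L[ℂ] B') :
    HolomorphicOn (fun x => L (f x)) U := by
  refine ⟨fun n => (hf.1 n).linear_comp (L.restrictScalars ℝ), fun x hx => ?_⟩
  obtain ⟨T, hT⟩ := hf.2 x hx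
  refine ⟨L.toLinearMap.comp T, fun h => ?_⟩
  have h1 := ((L.restrictScalars ℝ).continuous.tendsto _).comp (hT h)
  simp only [Function.comp_def, map_smul, map_sub] at h1
  exact h1

lemma HolomorphicOn.congr [ContinuousAdd X] [ContinuousSMul ℂ X] {f g : X → B} {U : Set X}
    (hU : IsOpen U) (hf : HolomorphicOn f U) (hfg : EqOn f g U) : HolomorphicOn g U := by
  have := continuousSMul_real_of_complex X
  refine ⟨fun n => (hf.1 n).congr hU hfg, fun x hx => ?_⟩
  obtain ⟨T, hT⟩ := hf.2 x hx
  exact ⟨T, fun h => (hT h).congr_of_eqOn hU hfg hx⟩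

lemma HolomorphicOn.of_local [ContinuousAdd X] [ContinuousSMul ℂ X] {f : X → B} {U : Set X}
    (h : ∀ x ∈ U, ∃ V, IsOpen V ∧ x ∈ V ∧ HolomorphicOn f V) : HolomorphicOn f U := by
  have := continuousSMul_real_of_complex X
  refine ⟨fun n => CnOn.of_local fun x hx => ?_, fun x hx => ?_⟩
  · obtain ⟨V, hV, hxV, h⟩ := h x hx
    exact ⟨V, hV, hxV, h.1 n⟩
  · obtain ⟨V, hV, hxV, h⟩ := h x hx
    exact h.2 x hxV

lemma HolomorphicMap.linear_comp {M : Type*} [TopologicalSpace M] [ChartedSpace X M] {f : M → B}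
    (hf : HolomorphicMap X B f) (L : B →L[ℂ] B') : HolomorphicMap X B' (fun x => L (f x)) :=
  InCharts.postcomp L.continuous (fun _ _ hf => hf.linear_comp L) hf

lemma HolomorphicMap.comp [ContinuousAdd X] [ContinuousSMul ℂ X]
    {M N : Type*} [TopologicalSpace M] [ChartedSpace X M]
    [TopologicalSpace N] [ChartedSpace Y N] {g : N → B} {f : M → N}
    (hg : HolomorphicMap Y B g) (hf : HolomorphicMap X Y f) :
    HolomorphicMap X B (fun x => g (f x)) :=
  InCharts.comp (P := HolomorphicOn) (Q := HolomorphicOn) (R := HolomorphicOn)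
    (fun _ _ _ _ hV hf hg hUV => hg.comp hV hf hUV) (fun _ _ _ hU hf hfg => hf.congr hU hfg)
    (fun _ _ h => HolomorphicOn.of_local h) hf hg

lemma HolomorphicMap.smoothMap {M : Type*} [TopologicalSpace M] [ChartedSpace X M] {f : M → B}
    (hf : HolomorphicMap X B f) : SmoothMap X B f :=
  ⟨hf.1, fun e he e' he' => (hf.2 e he e' he').1⟩

/-- A holomorphic function on the manifold `ℍ` is complex differentiable in the coordinate of the
upper half plane. -/
lemma HolomorphicMap.differentiableAt_upperHalfPlane {f : UpperHalfPlane → B}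
    (hf : HolomorphicMap ℂ B f) {g : ℂ → B} (hg : ∀ z : UpperHalfPlane, g z = f z)
    {z : ℂ} (hz : 0 < z.im) : DifferentiableAt ℂ g z := by
  let z' : UpperHalfPlane := ⟨z, hz⟩
  unfold HolomorphicMap at hf
  rw [inCharts_model_iff] at hf
  set e := chartAt ℂ z' with he
  have hez : ∀ w : UpperHalfPlane, e w = w := fun w => rfl
  have h1 := (hf.2 e (chart_mem_atlas _ _)).isGateauxOn e.open_target
  have hzt : z ∈ e.target := mem_chart_target ℂ z'
  have h2 := h1.differentiableAt (x := 0) (h := 1) (z := z) (by simpa using hzt)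
  refine h2.congr_of_eventuallyEq ?_
  filter_upwards [e.open_target.mem_nhds hzt] with w hw
  simp only [zero_add, smul_eq_mul, mul_one]
  rw [← hg, ← hez, e.right_inv hw]

end Holomorphic

end Manifolds

/-! ### The canonical map `S → C^*(S, α)` is holomorphic -/

section Eta

universe u

variable {F : Type*} [AddCommGroup F] [Module ℂ F] [TopologicalSpace F]
  {S : Type u} [Semigroup S] [StarMul S] [TopologicalSpace S] [ChartedSpace F S]
  {α : AbsVal S}

namespace HostCStar

/-- The canonical map of `ℂ[S]` into its completion `C^*(S, α)`, as a complex linear map. -/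
noncomputable def ofLinear (F : Type*) [AddCommGroup F] [Module ℂ F] [TopologicalSpace F]
    {S : Type u} [Semigroup S] [StarMul S] [TopologicalSpace S] [ChartedSpace F S]
    (α : AbsVal S) : SemigroupAlg F α →ₗ[ℂ] HostCStar F α where
  toFun := CStarCompletion.of
  map_add' := map_add _
  map_smul' := CStarCompletion.of_smul

lemma ofLinear_single (s : S) (c : ℂ) :
    ofLinear F α (SemigroupAlg.single F α s c) = c • eta F α s := by
  have : SemigroupAlg.single F α s c = c • SemigroupAlg.single F α s 1 := by
    rw [SemigroupAlg.smul_single, mul_one]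
  rw [this, map_smul]
  rfl

lemma norm_ofLinear (f : SemigroupAlg F α) : ‖ofLinear F α f‖ = SemigroupAlg.seminorm F α f :=
  CStarCompletion.norm_of f

lemma ofLinear_mul (f g : SemigroupAlg F α) :
    ofLinear F α (f * g) = ofLinear F α f * ofLinear F α g :=
  CStarCompletion.of_mul f g

lemma ofLinear_star (f : SemigroupAlg F α) :
    ofLinear F α (star f) = star (ofLinear F α f) :=
  CStarCompletion.of_star f

lemma denseRange_ofLinear : DenseRange (ofLinear F α) :=
  (CStarCompletion.isDenseInducing_of (R := SemigroupAlg F α)).dense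

lemma eta_mul (s t : S) : eta F α (s * t) = eta F α s * eta F α t := by
  have := ofLinear_mul (SemigroupAlg.single F α s 1) (SemigroupAlg.single F α t 1)
  simpa only [SemigroupAlg.single_mul_single, ofLinear_single, one_smul, mul_one] using this

lemma eta_star (s : S) : eta F α (star s) = star (eta F α s) := by
  have := ofLinear_star (SemigroupAlg.single F α s 1)
  simpa only [SemigroupAlg.star_single, ofLinear_single, one_smul, map_one] using this

lemma dense_span_eta : Dense (Submodule.span ℂ (range (eta F α)) : Set (HostCStar F α)) := by
  refine denseRange_ofLinear.mono ?_
  rintro _ ⟨f, rfl⟩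
  induction f using SemigroupAlg.induction_single with
  | zero => simp
  | add f g hf hg => rw [map_add]; exact add_mem hf hg
  | hs s c =>
    rw [ofLinear_single]
    exact Submodule.smul_mem _ _ (Submodule.subset_span ⟨s, rfl⟩)

/-- Norms in `C^*(S, α)` are estimated by evaluating `α`-bounded holomorphic morphisms. -/
lemma norm_ofLinear_le {f : SemigroupAlg F α} {C : ℝ} (hC : 0 ≤ C)
    (h : ∀ (A : Type u) [NonUnitalCStarAlgebra A] (β : S →ₙ* A),
      IsBoundedHolomorphicMorphism F α β → ‖SemigroupAlg.lift F α β f‖ ≤ C) :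
    ‖ofLinear F α f‖ ≤ C :=
  (norm_ofLinear f).trans_le (SemigroupAlg.seminorm_le hC h)

section Curve

variable {c : ℂ → S} {r C : ℝ}

lemma norm_eta_sub_le (hC : ∀ z ∈ Metric.ball (0 : ℂ) r, α (c z) ≤ C)
    (hd : ∀ (A : Type u) [NonUnitalCStarAlgebra A] (β : S →ₙ* A),
      IsBoundedHolomorphicMorphism F α β →
        DifferentiableOn ℂ (fun z => β (c z)) (Metric.ball 0 r))
    {t : ℂ} (ht : t ∈ Metric.ball (0 : ℂ) r) :
    ‖eta F α (c t) - eta F α (c 0)‖ ≤ (C + C) / r * ‖t‖ := by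
  have hr : 0 < r := Metric.pos_of_mem_ball ht
  have hC0 : 0 ≤ C := (α.nonneg _).trans (hC 0 (Metric.mem_ball_self hr))
  have h := norm_ofLinear_le (F := F) (α := α)
    (f := SemigroupAlg.single F α (c t) 1 - SemigroupAlg.single F α (c 0) 1)
    (C := (C + C) / r * ‖t‖) (by positivity) fun A _ β hβ => by
      rw [map_sub, SemigroupAlg.lift_single, SemigroupAlg.lift_single, one_smul, one_smul]
      exact norm_sub_le_of_bounded (hd A β hβ) (fun z hz => (hβ.norm_le _).trans (hC z hz)) ht
  simpa only [map_sub, ofLinear_single, one_smul] using h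

/-- Along a curve on which `α` is bounded and all morphisms are holomorphic, the canonical map is
complex differentiable, since its difference quotients are Cauchy uniformly in the morphisms. -/
lemma differentiableAt_eta_comp (hr : 0 < r) (hC : ∀ z ∈ Metric.ball (0 : ℂ) r, α (c z) ≤ C)
    (hd : ∀ (A : Type u) [NonUnitalCStarAlgebra A] (β : S →ₙ* A),
      IsBoundedHolomorphicMorphism F α β →
        DifferentiableOn ℂ (fun z => β (c z)) (Metric.ball 0 r)) :
    DifferentiableAt ℂ (fun z => eta F α (c z)) 0 := by
  have hC0 : 0 ≤ C := (α.nonneg _).trans (hC 0 (Metric.mem_ball_self hr))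
  set K := ((C + C) / r + (C + C) / r) / r with hK
  have hK0 : 0 ≤ K := by positivity
  let q : ℂ → SemigroupAlg F α := fun t =>
    t⁻¹ • (SemigroupAlg.single F α (c t) 1 - SemigroupAlg.single F α (c 0) 1)
  have hq : ∀ t, ofLinear F α (q t) = t⁻¹ • (eta F α (c t) - eta F α (c 0)) := fun t => by
    simp only [q, map_smul, map_sub, ofLinear_single, one_smul]
  have hlift : ∀ t ∈ Metric.ball (0 : ℂ) r, t ≠ 0 → ∀ (A : Type u) [NonUnitalCStarAlgebra A]
      (β : S →ₙ* A), IsBoundedHolomorphicMorphism F α β →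
      ‖SemigroupAlg.lift F α β (q t) - deriv (fun z => β (c z)) 0‖ ≤ K * ‖t‖ := by
    intro t ht ht0 A _ β hβ
    have := norm_dslope_sub_le_of_bounded (hd A β hβ)
      (fun z hz => (hβ.norm_le _).trans (hC z hz)) ht
    rw [dslope_of_ne _ ht0, slope_def_module, sub_zero] at this
    simpa only [q, map_smul, map_sub, SemigroupAlg.lift_single, one_smul] using this
  have hdiff : ∀ t ∈ Metric.ball (0 : ℂ) r, t ≠ 0 → ∀ s ∈ Metric.ball (0 : ℂ) r, s ≠ 0 →
      ‖ofLinear F α (q t - q s)‖ ≤ K * ‖t‖ + K * ‖s‖ := by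
    intro t ht ht0 s hs hs0
    refine norm_ofLinear_le (by positivity) fun A _ β hβ => ?_
    rw [map_sub, ← sub_sub_sub_cancel_right _ _ (deriv (fun z => β (c z)) 0)]
    exact (norm_sub_le _ _).trans (add_le_add (hlift t ht ht0 A β hβ) (hlift s hs hs0 A β hβ))
  have hcauchy : Cauchy (map (fun t => ofLinear F α (q t)) (𝓝[≠] (0 : ℂ))) := by
    rw [Metric.cauchy_iff]
    refine ⟨inferInstance, fun ε hε => ?_⟩
    have hlim : Tendsto (fun t : ℂ => K * ‖t‖) (𝓝[≠] 0) (𝓝 0) := by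
      have : Continuous fun t : ℂ => K * ‖t‖ := by fun_prop
      exact (this.tendsto' 0 0 (by simp)).mono_left nhdsWithin_le_nhds
    have hball : ∀ᶠ t : ℂ in 𝓝[≠] 0, t ∈ Metric.ball (0 : ℂ) r :=
      mem_nhdsWithin_of_mem_nhds (Metric.ball_mem_nhds _ hr)
    have hev := (hlim.eventually_lt_const (half_pos hε)).and
      (hball.and eventually_mem_nhdsWithin)
    refine ⟨_, image_mem_map hev, ?_⟩
    rintro _ ⟨t, ⟨ht, htr, ht0⟩, rfl⟩ _ ⟨s, ⟨hs, hsr, hs0⟩, rfl⟩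
    rw [dist_eq_norm, ← map_sub]
    exact (hdiff t htr ht0 s hsr hs0).trans_lt (by linarith)
  obtain ⟨v, hv⟩ := CompleteSpace.complete hcauchy
  refine HasDerivAt.differentiableAt (f' := v) ?_
  rw [hasDerivAt_iff_tendsto_slope_zero]
  refine Tendsto.congr (fun t => ?_) (show Tendsto _ _ _ from hv)
  rw [hq, zero_add]

end Curve

variable [ContinuousSMul ℂ F]

lemma exists_ball_line_mem {U : Set F} (hU : U ∈ 𝓝 (0 : F)) (h : F) :
    ∃ r > 0, ∀ z ∈ Metric.ball (0 : ℂ) r, z • h ∈ U := by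
  have : Continuous fun z : ℂ => z • h := by fun_prop
  exact Metric.eventually_nhds_iff_ball.1 ((this.tendsto' 0 0 (by simp)).eventually hU)

variable [IsTopologicalAddGroup F]

/-- If `α` is locally bounded, the canonical map `S → C^*(S, α)` is holomorphic. -/
theorem holomorphicMap_eta (hα : α.IsLocallyBounded) :
    HolomorphicMap F (HostCStar F α) (eta F α) := by
  have key : ∀ e ∈ atlas F S, ContinuousOn (fun x => eta F α (e.symm x)) e.target ∧
      IsGateauxOn (fun x => eta F α (e.symm x)) e.target := by
    intro e he
    have hβ : ∀ (A : Type u) [NonUnitalCStarAlgebra A] (β : S →ₙ* A),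
        IsBoundedHolomorphicMorphism F α β → IsGateauxOn (fun x => β (e.symm x)) e.target := by
      intro A _ β hβ
      have := hβ.holomorphic
      unfold HolomorphicMap at this
      rw [inCharts_model_iff] at this
      exact (this.2 e he).isGateauxOn e.open_target
    -- a balanced neighbourhood on which `α` is bounded
    have hnhds : ∀ x ∈ e.target, ∃ (V : Set F) (C : ℝ), V ∈ 𝓝 (0 : F) ∧ Balanced ℂ V ∧
        ∀ y ∈ V, x + y ∈ e.target ∧ α (e.symm (x + y)) ≤ C := by
      intro x hx
      obtain ⟨U, hU, C, hC⟩ := hα (e.symm x)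
      have h1 : ∀ᶠ y in 𝓝 x, y ∈ e.target ∧ α (e.symm y) ≤ C := by
        filter_upwards [e.open_target.mem_nhds hx, (e.continuousAt_symm hx).eventually hU]
          with y hy hy'
        exact ⟨hy, hC _ hy'⟩
      have h2 : Continuous fun y : F => x + y := by fun_prop
      have h3 := (h2.tendsto' 0 x (by simp)).eventually h1
      exact ⟨balancedCore ℂ _, C, balancedCore_mem_nhds_zero h3, balancedCore_balanced _,
        fun y hy => (balancedCore_subset (𝕜 := ℂ) _ hy :)⟩
    -- on such a neighbourhood, the curves along complex lines satisfy uniform estimates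
    have hcurve : ∀ (x h : F) (r C : ℝ), (∀ z ∈ Metric.ball (0 : ℂ) r, x + z • h ∈ e.target ∧
          α (e.symm (x + z • h)) ≤ C) → ∀ (A : Type u) [NonUnitalCStarAlgebra A] (β : S →ₙ* A),
        IsBoundedHolomorphicMorphism F α β →
          DifferentiableOn ℂ (fun z : ℂ => β (e.symm (x + z • h))) (Metric.ball 0 r) :=
      fun x h r C hz A _ β h' z hz' =>
        ((hβ A β h').differentiableAt (hz z hz').1).differentiableWithinAt
    refine ⟨fun x hx => ContinuousAt.continuousWithinAt ?_, fun x hx h => ?_⟩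
    · obtain ⟨V, C, hV, hbal, hVC⟩ := hnhds x hx
      rw [Metric.continuousAt_iff']
      intro ε hε
      have hlim : Tendsto (fun t : ℂ => (C + C) / 1 * ‖t‖) (𝓝[≠] 0) (𝓝 0) := by
        have : Continuous fun t : ℂ => (C + C) / 1 * ‖t‖ := by fun_prop
        exact (this.tendsto' 0 0 (by simp)).mono_left nhdsWithin_le_nhds
      have hball : ∀ᶠ t : ℂ in 𝓝[≠] 0, t ∈ Metric.ball (0 : ℂ) 1 :=
        mem_nhdsWithin_of_mem_nhds (Metric.ball_mem_nhds _ one_pos)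
      obtain ⟨t, htε, ht1, ht0⟩ :=
        ((hlim.eventually_lt_const hε).and (hball.and eventually_mem_nhdsWithin)).exists
      have hsub : Continuous fun y : F => t⁻¹ • (y - x) := by fun_prop
      filter_upwards [(hsub.tendsto' x 0 (by simp)).eventually hV] with y hy
      have hz : ∀ z ∈ Metric.ball (0 : ℂ) 1, x + z • t⁻¹ • (y - x) ∈ e.target ∧
          α (e.symm (x + z • t⁻¹ • (y - x))) ≤ C := fun z hz =>
        hVC _ (hbal.smul_mem (by simpa using (mem_ball_zero_iff.1 hz).le) hy)
      have h1 := norm_eta_sub_le (F := F) (c := fun z => e.symm (x + z • t⁻¹ • (y - x)))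
        (fun z h' => (hz z h').2) (hcurve _ _ 1 C hz) ht1
      rw [smul_inv_smul₀ ht0, add_sub_cancel, zero_smul, add_zero] at h1
      rw [dist_eq_norm]
      exact h1.trans_lt htε
    · obtain ⟨V, C, hV, -, hVC⟩ := hnhds x hx
      obtain ⟨r, hr, hrV⟩ := exists_ball_line_mem hV h
      have hz : ∀ z ∈ Metric.ball (0 : ℂ) r, x + z • h ∈ e.target ∧
          α (e.symm (x + z • h)) ≤ C := fun z hz => hVC _ (hrV z hz)
      exact differentiableAt_eta_comp (c := fun z => e.symm (x + z • h)) hr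
        (fun z h' => (hz z h').2) (hcurve _ _ r C hz)
  unfold HolomorphicMap
  rw [inCharts_model_iff]
  refine ⟨continuous_iff_continuousAt.2 fun s => ?_, fun e he =>
    (key e he).2.holomorphicOn e.open_target (key e he).1⟩
  set e := chartAt F s
  have hs : s ∈ e.source := mem_chart_source F s
  have h1 := ((key e (chart_mem_atlas F s)).1.continuousAt
    (e.open_target.mem_nhds (e.map_source hs))).comp (e.continuousAt hs)
  refine h1.congr ?_
  filter_upwards [e.open_source.mem_nhds hs] with s' hs'
  simp only [Function.comp, e.left_inv hs']

end HostCStar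

end Eta

/-! ### Unitary multipliers of `S` act on `C^*(S, α)` -/

section Multipliers

universe u

/-- A multiplier of a C*-algebra is determined by its left component. -/
lemma doubleCentralizer_ext_fst {A : Type*} [NonUnitalCStarAlgebra A] {m n : 𝓜(ℂ, A)}
    (h : m.fst = n.fst) : m = n := by
  refine DoubleCentralizer.ext _ _ _ _ (Prod.ext h (ContinuousLinearMap.ext fun x => ?_))
  have h1 : ∀ y, (m.snd x - n.snd x) * y = 0 := fun y => by
    rw [sub_mul, m.central, n.central, h, sub_self]
  exact sub_eq_zero.1 (CStarRing.mul_star_self_eq_zero_iff _ |>.1 (h1 _))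

namespace Multiplier

variable {S : Type*} [Semigroup S] [StarMul S]

lemma star_left (m : Multiplier S) (s : S) : (star m).left s = star (m.right (star s)) := rfl

lemma star_mul_of_unitary {m : Multiplier S} (hm : m ∈ unitary (Multiplier S)) (s t : S) :
    star (m.left s) * m.left t = star s * t := by
  have h : star (m.right (star (m.left s))) = s :=
    congrFun (congrArg Multiplier.left (Unitary.star_mul_self_of_mem hm)) s
  rw [m.mul_left]
  congr 1
  rw [← h, star_star, h]

end Multiplier

namespace HostCStar

variable {F : Type*} [AddCommGroup F] [Module ℂ F] [TopologicalSpace F]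
  {S : Type u} [Semigroup S] [StarMul S] [TopologicalSpace S] [ChartedSpace F S]
  {α : AbsVal S}

lemma clm_ext {B : Type*} [AddCommGroup B] [Module ℂ B] [TopologicalSpace B] [T2Space B]
    {f g : HostCStar F α →L[ℂ] B} (h : ∀ s, f (eta F α s) = g (eta F α s)) : f = g := by
  refine ContinuousLinearMap.ext_on dense_span_eta ?_
  rintro _ ⟨s, rfl⟩
  exact h s

/-- The linear map `∑ f(s) δ_s ↦ ∑ f(s) η_α(m s)` defined by a multiplier `m`. -/
noncomputable def leftLinear (F : Type*) [AddCommGroup F] [Module ℂ F] [TopologicalSpace F]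
    {S : Type u} [Semigroup S] [StarMul S] [TopologicalSpace S] [ChartedSpace F S]
    (α : AbsVal S) (m : Multiplier S) : SemigroupAlg F α →ₗ[ℂ] HostCStar F α :=
  (Finsupp.linearCombination ℂ fun s => eta F α (m.left s)).comp
    (MonoidAlgebra.coeffLinearEquiv (S := ℂ) (M := S) ℂ).toLinearMap

lemma leftLinear_single (m : Multiplier S) (s : S) (c : ℂ) :
    leftLinear F α m (SemigroupAlg.single F α s c) = c • eta F α (m.left s) := by
  change Finsupp.linearCombination ℂ _ (Finsupp.single s c) = _
  rw [Finsupp.linearCombination_single]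

lemma star_leftLinear_mul {m : Multiplier S} (hm : m ∈ unitary (Multiplier S))
    (f g : SemigroupAlg F α) :
    star (leftLinear F α m f) * leftLinear F α m g = ofLinear F α (star f * g) := by
  induction f using SemigroupAlg.induction_single with
  | zero => simp
  | add f f' hf hf' => simp only [map_add, star_add, add_mul, hf, hf']
  | hs s c =>
    induction g using SemigroupAlg.induction_single with
    | zero => simp
    | add g g' hg hg' => simp only [map_add, mul_add, hg, hg']
    | hs t d =>
      rw [leftLinear_single, leftLinear_single, star_smul, ← eta_star, smul_mul_smul_comm,
        ← eta_mul, Multiplier.star_mul_of_unitary hm, SemigroupAlg.star_single,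
        SemigroupAlg.single_mul_single, ofLinear_single]
      rfl

/-- Left multiplication by a unitary multiplier preserves `f^* f`, so that the C*-identity makes it
isometric. -/
lemma norm_leftLinear {m : Multiplier S} (hm : m ∈ unitary (Multiplier S)) (f : SemigroupAlg F α) :
    ‖leftLinear F α m f‖ = ‖ofLinear F α f‖ := by
  rw [← mul_self_inj (norm_nonneg _) (norm_nonneg _), ← CStarRing.norm_star_mul_self,
    ← CStarRing.norm_star_mul_self, star_leftLinear_mul hm, ofLinear_mul, ofLinear_star]

/-- The action of a unitary multiplier on `C^*(S, α)` from the left: the continuous extension of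
`leftLinear`, which is meaningful when `m` is unitary and `leftLinear` therefore isometric. -/
noncomputable def leftOp (F : Type*) [AddCommGroup F] [Module ℂ F] [TopologicalSpace F]
    {S : Type u} [Semigroup S] [StarMul S] [TopologicalSpace S] [ChartedSpace F S]
    (α : AbsVal S) (m : Multiplier S) : HostCStar F α →L[ℂ] HostCStar F α :=
  (leftLinear F α m).extendOfNorm (ofLinear F α)

lemma leftOp_eta {m : Multiplier S} (hm : m ∈ unitary (Multiplier S)) (s : S) :
    leftOp F α m (eta F α s) = eta F α (m.left s) := by
  have h := LinearMap.extendOfNorm_eq (f := leftLinear F α m) (e := ofLinear F α)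
    denseRange_ofLinear ⟨1, fun f => by rw [norm_leftLinear hm, one_mul]⟩
    (SemigroupAlg.single F α s 1)
  rwa [leftLinear_single, ofLinear_single, one_smul, one_smul] at h

/-- The multiplier of `C^*(S, α)` defined by a unitary multiplier of `S`. -/
noncomputable def toMultiplier (F : Type*) [AddCommGroup F] [Module ℂ F] [TopologicalSpace F]
    {S : Type u} [Semigroup S] [StarMul S] [TopologicalSpace S] [ChartedSpace F S]
    (α : AbsVal S) (m : unitary (Multiplier S)) : 𝓜(ℂ, HostCStar F α) where
  fst := leftOp F α m
  snd := (((starₗᵢ ℂ : HostCStar F α ≃ₗᵢ⋆[ℂ] HostCStar F α) :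
      HostCStar F α →L⋆[ℂ] HostCStar F α).comp (leftOp F α (star m : unitary (Multiplier S)))).comp
    ((starₗᵢ ℂ : HostCStar F α ≃ₗᵢ⋆[ℂ] HostCStar F α) : HostCStar F α →L⋆[ℂ] HostCStar F α)
  central := by
    set R := (((starₗᵢ ℂ : HostCStar F α ≃ₗᵢ⋆[ℂ] HostCStar F α) :
      HostCStar F α →L⋆[ℂ] HostCStar F α).comp (leftOp F α (star m : unitary (Multiplier S)))).comp
      ((starₗᵢ ℂ : HostCStar F α ≃ₗᵢ⋆[ℂ] HostCStar F α) : HostCStar F α →L⋆[ℂ] HostCStar F α)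
    have hR : ∀ x, R x = star (leftOp F α (star m : unitary (Multiplier S)) (star x)) :=
      fun x => rfl
    have h1 : ∀ s t, R (eta F α s) * eta F α t = eta F α s * leftOp F α m (eta F α t) := by
      intro s t
      rw [hR, ← eta_star, leftOp_eta (star m).2, leftOp_eta m.2, ← eta_star, ← eta_mul, ← eta_mul,
        Unitary.coe_star, Multiplier.star_left, star_star, star_star, Multiplier.mul_left]
    have h2 : ∀ t x, R x * eta F α t = x * leftOp F α m (eta F α t) := fun t x =>
      DFunLike.congr_fun (clm_ext
        (f := ((ContinuousLinearMap.mul ℂ (HostCStar F α)).flip (eta F α t)).comp R)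
        (g := (ContinuousLinearMap.mul ℂ (HostCStar F α)).flip (leftOp F α m (eta F α t)))
        fun s => h1 s t) x
    exact fun x y => DFunLike.congr_fun (clm_ext
        (f := ContinuousLinearMap.mul ℂ (HostCStar F α) (R x))
        (g := (ContinuousLinearMap.mul ℂ (HostCStar F α) x).comp (leftOp F α m))
        fun t => h2 t x) y

lemma toMultiplier_fst_eta (m : unitary (Multiplier S)) (s : S) :
    (toMultiplier F α m).fst (eta F α s) = eta F α ((m : Multiplier S).left s) :=
  leftOp_eta m.2 s

/-- A multiplier of `C^*(S, α)` is determined by its left action on the elements `η_α(s)`. -/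
lemma multiplier_ext {m n : 𝓜(ℂ, HostCStar F α)}
    (h : ∀ s, m.fst (eta F α s) = n.fst (eta F α s)) : m = n :=
  doubleCentralizer_ext_fst (clm_ext h)

lemma toMultiplier_one : toMultiplier F α (1 : unitary (Multiplier S)) = 1 :=
  multiplier_ext fun s => toMultiplier_fst_eta 1 s

lemma toMultiplier_mul (m n : unitary (Multiplier S)) :
    toMultiplier F α (m * n) = toMultiplier F α m * toMultiplier F α n :=
  multiplier_ext fun s => by
    rw [DoubleCentralizer.mul_fst, ContinuousLinearMap.mul_def,
      ContinuousLinearMap.comp_apply, toMultiplier_fst_eta,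
      toMultiplier_fst_eta, toMultiplier_fst_eta]
    rfl

lemma toMultiplier_star (m : unitary (Multiplier S)) :
    toMultiplier F α (star m) = star (toMultiplier F α m) :=
  multiplier_ext fun s => by
    rw [DoubleCentralizer.star_fst]
    change _ = star (star (leftOp F α (star m : unitary (Multiplier S))
      (star (star (eta F α s)))))
    rw [star_star, star_star]
    rfl

/-- The homomorphism of the unitary group of `M(S)` to the unitary group of `M(C^*(S, α))`. -/
noncomputable def unitaryHom (F : Type*) [AddCommGroup F] [Module ℂ F] [TopologicalSpace F]
    {S : Type u} [Semigroup S] [StarMul S] [TopologicalSpace S] [ChartedSpace F S]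
    (α : AbsVal S) : unitary (Multiplier S) →* unitary 𝓜(ℂ, HostCStar F α) where
  toFun m := ⟨toMultiplier F α m, by
    rw [Unitary.mem_iff, ← toMultiplier_star, ← toMultiplier_mul, ← toMultiplier_mul,
      Unitary.star_mul_self, Unitary.mul_star_self, toMultiplier_one]
    exact ⟨rfl, rfl⟩⟩
  map_one' := Subtype.ext toMultiplier_one
  map_mul' m n := Subtype.ext (toMultiplier_mul m n)

end HostCStar

end Multipliers

/-! ### Extension of representations to the multiplier algebra -/

section Representation

variable {A : Type*} [NonUnitalCStarAlgebra A] {H : Type*} [NormedAddCommGroup H]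
  [InnerProductSpace ℂ H] [CompleteSpace H]

lemma rep_star_inner (π : A →⋆ₙₐ[ℂ] (H →L[ℂ] H)) (a : A) (v w : H) :
    ⟪π a v, w⟫_ℂ = ⟪v, π (star a) w⟫_ℂ := by
  rw [map_star, ContinuousLinearMap.star_eq_adjoint, ContinuousLinearMap.adjoint_inner_right]

/-- A representation as a continuous linear map. -/
noncomputable def repCLM (π : A →⋆ₙₐ[ℂ] (H →L[ℂ] H)) : A →L[ℂ] (H →L[ℂ] H) :=
  LinearMap.mkContinuous
    { toFun := π, map_add' := map_add π, map_smul' := map_smul π } 1 fun a => by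
      rw [one_mul]
      exact NonUnitalStarAlgHom.norm_apply_le π a

lemma rep_continuous (π : A →⋆ₙₐ[ℂ] (H →L[ℂ] H)) : Continuous π := (repCLM π).continuous

lemma doubleCentralizer_fst_mul (m : 𝓜(ℂ, A)) (a b : A) : m.fst (a * b) = m.fst a * b := by
  have h : ∀ c, c * (m.fst (a * b) - m.fst a * b) = 0 := fun c => by
    rw [mul_sub, ← mul_assoc, ← m.central, ← m.central, mul_assoc, sub_self]
  exact sub_eq_zero.1 (CStarRing.star_mul_self_eq_zero_iff _ |>.1 (h _))

lemma exists_approxUnit (A : Type*) [NonUnitalCStarAlgebra A] : ∃ l : Filter A, l.NeBot ∧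
    (∀ a, Tendsto (fun u => u * a) l (𝓝 a)) ∧ ∀ᶠ u in l, ‖u‖ ≤ 1 := by
  let _ := CStarAlgebra.spectralOrder A
  have _ := CStarAlgebra.spectralOrderedRing A
  have h := CStarAlgebra.increasingApproximateUnit A
  exact ⟨_, h.neBot, h.tendsto_mul_right, h.eventually_norm⟩

/-- The vectors `∑ π(a_i) v_i`, parametrized by formal linear combinations of pairs `(a, v)`. -/
noncomputable def repSpan (π : A →⋆ₙₐ[ℂ] (H →L[ℂ] H)) : (A × H →₀ ℂ) →ₗ[ℂ] H :=
  Finsupp.linearCombination ℂ fun p => π p.1 p.2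

/-- The vectors `∑ π(m a_i) v_i`. -/
noncomputable def multSpan (π : A →⋆ₙₐ[ℂ] (H →L[ℂ] H)) (m : 𝓜(ℂ, A)) : (A × H →₀ ℂ) →ₗ[ℂ] H :=
  Finsupp.linearCombination ℂ fun p => π (m.fst p.1) p.2

/-- If `T` spans a dense subspace of `A`, the vectors `π(a) v` with `a ∈ T` span a dense subspace of
the Hilbert space. -/
lemma IsNondegenerate.dense_span {π : A →⋆ₙₐ[ℂ] (H →L[ℂ] H)} (hπ : IsNondegenerate π) {T : Set A}
    (hT : Dense (Submodule.span ℂ T : Set A)) :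
    Dense (Submodule.span ℂ {w | ∃ a ∈ T, ∃ v, w = π a v} : Set H) := by
  rw [Submodule.dense_iff_topologicalClosure_eq_top, Submodule.topologicalClosure_eq_top_iff,
    Submodule.eq_bot_iff]
  intro w hw
  rw [Submodule.mem_orthogonal] at hw
  have h1 : ∀ v, ∀ a, ⟪π a v, w⟫_ℂ = 0 := by
    intro v
    -- `a ↦ ⟪w, π(a) v⟫` is a continuous linear functional which vanishes on `T`
    have h2 : ((innerSL ℂ w).comp ((ContinuousLinearMap.apply ℂ H v).comp
        (repCLM π))) = 0 := by
      refine ContinuousLinearMap.ext_on hT fun a ha => ?_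
      have := hw (π a v) (Submodule.subset_span ⟨a, ha, v, rfl⟩)
      rw [inner_eq_zero_symm] at this
      exact this
    intro a
    rw [inner_eq_zero_symm]
    exact DFunLike.congr_fun h2 a
  refine hπ w fun a => ?_
  have h3 := h1 (π a w) (star a)
  rw [rep_star_inner, star_star] at h3
  exact inner_self_eq_zero.1 h3

lemma IsNondegenerate.denseRange_repSpan {π : A →⋆ₙₐ[ℂ] (H →L[ℂ] H)} (hπ : IsNondegenerate π) :
    DenseRange (repSpan π) := by
  have h := hπ.dense_span (T := univ) (by simp)
  refine h.mono ?_
  change _ ⊆ (LinearMap.range (repSpan π) : Set H)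
  rw [SetLike.coe_subset_coe, Submodule.span_le]
  rintro _ ⟨a, -, v, rfl⟩
  exact ⟨Finsupp.single (a, v) 1, by simp [repSpan]⟩

/-- With an approximate unit `u`, the vector `∑ π(m a_i) v_i` is the limit of the vectors
`π(m u) ∑ π(a_i) v_i`. -/
lemma norm_multSpan_le (π : A →⋆ₙₐ[ℂ] (H →L[ℂ] H)) (m : 𝓜(ℂ, A)) (x : A × H →₀ ℂ) :
    ‖multSpan π m x‖ ≤ ‖m.fst‖ * ‖repSpan π x‖ := by
  obtain ⟨l, hl, hu, hb⟩ := exists_approxUnit A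
  have hlim : Tendsto (fun u => π (m.fst u) (repSpan π x)) l (𝓝 (multSpan π m x)) := by
    induction x using Finsupp.induction_linear with
    | zero => simp
    | add x y hx hy => simpa only [map_add] using hx.add hy
    | single p c =>
      have h1 : Tendsto (fun u => c • π (m.fst (u * p.1)) p.2) l
          (𝓝 (c • π (m.fst p.1) p.2)) := by
        have h2 : Continuous fun a => c • π (m.fst a) p.2 :=
          (((rep_continuous π).comp m.fst.continuous).clm_apply continuous_const).const_smul c
        exact (h2.tendsto _).comp (hu p.1)
      refine Tendsto.congr (fun u => ?_) (by simpa [multSpan] using h1)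
      simp [repSpan, doubleCentralizer_fst_mul]
  refine le_of_tendsto hlim.norm (hb.mono fun u hu => ?_)
  refine ((π (m.fst u)).le_opNorm _).trans (mul_le_mul_of_nonneg_right ?_ (norm_nonneg _))
  refine (NonUnitalStarAlgHom.norm_apply_le π _).trans ((m.fst.le_opNorm u).trans ?_)
  exact mul_le_of_le_one_right (norm_nonneg _) hu

/-- The operator `ρ(m)` with `ρ(m) π(a) v = π(m a) v`, meaningful when `π` is non-degenerate. -/
noncomputable def extOp (π : A →⋆ₙₐ[ℂ] (H →L[ℂ] H)) (m : 𝓜(ℂ, A)) : H →L[ℂ] H :=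
  (multSpan π m).extendOfNorm (repSpan π)

lemma IsNondegenerate.extOp_apply {π : A →⋆ₙₐ[ℂ] (H →L[ℂ] H)} (hπ : IsNondegenerate π)
    (m : 𝓜(ℂ, A)) (a : A) (v : H) :
    extOp π m (π a v) = π (m.fst a) v := by
  have h := LinearMap.extendOfNorm_eq (f := multSpan π m) (e := repSpan π) hπ.denseRange_repSpan
    ⟨_, norm_multSpan_le π m⟩ (Finsupp.single (a, v) 1)
  simpa [extOp, multSpan, repSpan] using h

lemma IsNondegenerate.clm_ext {π : A →⋆ₙₐ[ℂ] (H →L[ℂ] H)} (hπ : IsNondegenerate π)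
    {T T' : H →L[ℂ] H} (h : ∀ a v, T (π a v) = T' (π a v)) : T = T' := by
  refine ContinuousLinearMap.ext_on (hπ.dense_span (T := univ) (by simp)) ?_
  rintro _ ⟨a, -, v, rfl⟩
  exact h a v

lemma IsNondegenerate.exists_extension {π : A →⋆ₙₐ[ℂ] (H →L[ℂ] H)} (hπ : IsNondegenerate π) :
    ∃ ρ : 𝓜(ℂ, A) →⋆ₐ[ℂ] (H →L[ℂ] H), IsMultiplierExtension π ρ := by
  refine ⟨
    { toFun := extOp π
      map_one' := hπ.clm_ext fun a v => by rw [hπ.extOp_apply]; rfl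
      map_mul' := fun m n => hπ.clm_ext fun a v => by
        rw [ContinuousLinearMap.mul_def, ContinuousLinearMap.comp_apply, hπ.extOp_apply,
          hπ.extOp_apply, hπ.extOp_apply]
        rfl
      map_zero' := hπ.clm_ext fun a v => by rw [hπ.extOp_apply]; simp
      map_add' := fun m n => hπ.clm_ext fun a v => by
        rw [add_apply, hπ.extOp_apply, hπ.extOp_apply, hπ.extOp_apply]
        simp
      commutes' := fun c => hπ.clm_ext fun a v => by
        rw [hπ.extOp_apply, DoubleCentralizer.algebraMap_fst, Algebra.algebraMap_eq_smul_one,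
          Algebra.algebraMap_eq_smul_one]
        simp
      map_star' := fun m => hπ.clm_ext fun a v => ?_ }, fun a => hπ.clm_ext fun b v => ?_⟩
  · refine ext_inner_left ℂ fun w => ?_
    rw [ContinuousLinearMap.star_eq_adjoint, ContinuousLinearMap.adjoint_inner_right,
      hπ.extOp_apply]
    -- by continuity it suffices to test against the vectors `π(b) w`
    have h : (innerSL ℂ (π ((star m).fst a) v)) = (innerSL ℂ (π a v)).comp (extOp π m) := by
      refine ContinuousLinearMap.ext_on (hπ.dense_span (T := univ) (by simp)) ?_
      rintro _ ⟨b, -, w, rfl⟩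
      rw [ContinuousLinearMap.comp_apply, hπ.extOp_apply, innerSL_apply_apply, innerSL_apply_apply,
        rep_star_inner, rep_star_inner, ← ContinuousLinearMap.comp_apply,
        ← ContinuousLinearMap.comp_apply, ← ContinuousLinearMap.mul_def,
        ← ContinuousLinearMap.mul_def, ← map_mul, ← map_mul, DoubleCentralizer.star_fst, star_star,
        m.central]
    have h' := DFunLike.congr_fun h w
    rw [ContinuousLinearMap.comp_apply, innerSL_apply_apply, innerSL_apply_apply] at h'
    rw [← inner_conj_symm, h', inner_conj_symm]
  · change extOp π _ _ = _
    rw [hπ.extOp_apply, DoubleCentralizer.coe_fst, ContinuousLinearMap.mul_apply', map_mul]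
    rfl

lemma IsMultiplierExtension.apply_apply {π : A →⋆ₙₐ[ℂ] (H →L[ℂ] H)}
    {ρ : 𝓜(ℂ, A) →⋆ₐ[ℂ] (H →L[ℂ] H)} (h : IsMultiplierExtension π ρ) (m : 𝓜(ℂ, A)) (a : A) (v : H) :
    ρ m (π a v) = π (m.fst a) v := by
  have hm : m * DoubleCentralizer.coe ℂ a = DoubleCentralizer.coe ℂ (m.fst a) := by
    refine doubleCentralizer_ext_fst (ContinuousLinearMap.ext fun b => ?_)
    exact doubleCentralizer_fst_mul m a b
  rw [← h a, ← h (m.fst a), ← hm, map_mul]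
  rfl

/-- If the orbit maps `g ↦ γ(g) a` are continuous for all `a` in a dense set, then the unitary
representation defined by a non-degenerate representation is strongly continuous. -/
lemma IsNondegenerate.continuous_extension {π : A →⋆ₙₐ[ℂ] (H →L[ℂ] H)} (hπ : IsNondegenerate π)
    {ρ : 𝓜(ℂ, A) →⋆ₐ[ℂ] (H →L[ℂ] H)} (h : IsMultiplierExtension π ρ)
    {G : Type*} [Group G] [TopologicalSpace G] (γ : G →* unitary 𝓜(ℂ, A)) {T : Set A}
    (hT : Dense (Submodule.span ℂ T : Set A))
    (hγ : ∀ a ∈ T, Continuous fun g => (γ g : 𝓜(ℂ, A)).fst a) (v : H) :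
    Continuous fun g => ρ (γ g : 𝓜(ℂ, A)) v := by
  have hnorm : ∀ g w, ‖ρ (γ g : 𝓜(ℂ, A)) w‖ ≤ ‖w‖ := by
    intro g w
    have h1 : ρ (γ g : 𝓜(ℂ, A)) ∈ unitary (H →L[ℂ] H) := Unitary.map_mem ρ (γ g).2
    exact (ContinuousLinearMap.norm_map_of_mem_unitary h1 w).le
  have hspan : ∀ w ∈ Submodule.span ℂ {w | ∃ a ∈ T, ∃ v, w = π a v},
      Continuous fun g => ρ (γ g : 𝓜(ℂ, A)) w := by
    intro w hw
    induction hw using Submodule.span_induction with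
    | mem w hw =>
      obtain ⟨a, ha, v, rfl⟩ := hw
      simp only [h.apply_apply]
      exact ((rep_continuous π).comp (hγ a ha)).clm_apply continuous_const
    | zero => simpa using continuous_const
    | add x y _ _ hx hy => simpa only [map_add] using! hx.add hy
    | smul c x _ hx => simpa only [map_smul] using! hx.const_smul c
  rw [continuous_iff_continuousAt]
  intro g
  rw [Metric.continuousAt_iff']
  intro ε hε
  obtain ⟨w, hw, hwv⟩ := (hπ.dense_span hT).exists_dist_lt v (show 0 < ε / 3 by positivity)
  filter_upwards [Metric.continuousAt_iff'.1 (hspan w hw).continuousAt (ε / 3) (by positivity)]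
    with g' hg'
  have h1 : ∀ g, dist (ρ (γ g : 𝓜(ℂ, A)) v) (ρ (γ g : 𝓜(ℂ, A)) w) < ε / 3 := fun g => by
    rw [dist_eq_norm, ← map_sub]
    exact (hnorm g _).trans_lt (by rwa [← dist_eq_norm])
  have h2 := h1 g
  rw [dist_comm] at h2
  calc _ ≤ _ := dist_triangle4 _ _ _ _
    _ < ε / 3 + ε / 3 + ε / 3 := add_lt_add (add_lt_add (h1 g') hg') h2
    _ = ε := by ring

end Representation

/-! ### Uniqueness for boundary values on the upper half plane -/

section HalfPlane

open Complex

/-- A function which is continuous on the closed upper half plane, holomorphic in the interior, and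
zero on the real axis vanishes. Rotating the function about `z₀` by the four powers of `i` and
multiplying gives a function on the square with centre `z₀` and one edge on the real axis. It
vanishes on the boundary of the square, hence at `z₀`. -/
lemma eq_zero_of_boundary_zero {k : ℂ → ℂ} (hc : ContinuousOn k {z | 0 ≤ z.im})
    (hd : ∀ z : ℂ, 0 < z.im → DifferentiableAt ℂ k z) (h0 : ∀ t : ℝ, k t = 0) {z₀ : ℂ}
    (hz : 0 < z₀.im) : k z₀ = 0 := by
  set ε := z₀.im
  have hreal : ∀ z : ℂ, z.im = 0 → k z = 0 := fun z hz => by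
    have : z = (z.re : ℂ) := Complex.ext (by simp) (by simpa using hz)
    rw [this, h0]
  let P : ℂ → ℂ := fun w => k (z₀ + w) * k (z₀ - w) * (k (z₀ + I * w) * k (z₀ - I * w))
  set U : Set ℂ := Ioo (-ε) ε ×ℂ Ioo (-ε) ε with hU
  have hne : -ε ≠ ε := by linarith
  have hcl : closure U = Icc (-ε) ε ×ℂ Icc (-ε) ε := by
    rw [hU, closure_reProdIm, closure_Ioo hne]
  have hfr : frontier U = Icc (-ε) ε ×ℂ {-ε, ε} ∪ {-ε, ε} ×ℂ Icc (-ε) ε := by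
    rw [hU, frontier_reProdIm, closure_Ioo hne, frontier_Ioo (by linarith)]
  have hP : DiffContOnCl ℂ P U := by
    constructor
    · intro w hw
      rw [hU, mem_reProdIm] at hw
      obtain ⟨⟨h1, h2⟩, h3, h4⟩ := hw
      have e1 : DifferentiableAt ℂ (fun w => k (z₀ + w)) w :=
        (hd _ (by simp only [add_im]; linarith)).comp w (by fun_prop)
      have e2 : DifferentiableAt ℂ (fun w => k (z₀ - w)) w :=
        (hd _ (by simp only [sub_im]; linarith)).comp w (by fun_prop)
      have e3 : DifferentiableAt ℂ (fun w => k (z₀ + I * w)) w :=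
        (hd _ (by simp [add_im]; linarith)).comp w (by fun_prop)
      have e4 : DifferentiableAt ℂ (fun w => k (z₀ - I * w)) w :=
        (hd _ (by simp [sub_im]; linarith)).comp w (by fun_prop)
      exact ((e1.mul e2).mul (e3.mul e4)).differentiableWithinAt
    · rw [hcl]
      have e : ∀ f : ℂ → ℂ, Continuous f → (∀ w ∈ Icc (-ε) ε ×ℂ Icc (-ε) ε, 0 ≤ (f w).im) →
          ContinuousOn (fun w => k (f w)) (Icc (-ε) ε ×ℂ Icc (-ε) ε) := fun f hf h =>
        hc.comp hf.continuousOn h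
      refine ((e _ (by fun_prop) ?_).mul (e _ (by fun_prop) ?_)).mul
        ((e _ (by fun_prop) ?_).mul (e _ (by fun_prop) ?_)) <;>
      · intro w hw
        rw [mem_reProdIm] at hw
        obtain ⟨⟨h1, h2⟩, h3, h4⟩ := hw
        simp
        linarith
  have hb : Bornology.IsBounded U := (Metric.isBounded_Ioo _ _).reProdIm (Metric.isBounded_Ioo _ _)
  have h := Complex.norm_le_of_forall_mem_frontier_norm_le hb hP (C := 0) (fun w hw => ?_)
    (z := 0) (subset_closure (by simp [hU, mem_reProdIm, hz]))
  · simpa [P] using norm_le_zero_iff.1 h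
  · rw [norm_le_zero_iff]
    rw [hfr] at hw
    rcases hw with ⟨-, hw | hw⟩ | ⟨hw | hw, -⟩
    · have : k (z₀ + w) = 0 := hreal _ (by rw [add_im, show w.im = -ε from hw]; ring)
      simp [P, this]
    · have : k (z₀ - w) = 0 := hreal _ (by rw [sub_im, show w.im = ε from hw]; ring)
      simp [P, this]
    · have : k (z₀ + I * w) = 0 := hreal _ (by
        rw [add_im, I_mul_im, show w.re = -ε from hw]; ring)
      simp [P, this]
    · have : k (z₀ - I * w) = 0 := hreal _ (by
        rw [sub_im, I_mul_im, show w.re = ε from hw]; ring)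
      simp [P, this]

lemma ClosedHalfPlane.continuous_invol : Continuous ClosedHalfPlane.invol :=
  Continuous.subtype_mk (continuous_conj.comp continuous_subtype_val).neg _

end HalfPlane

/-! ### The host algebra -/

section Host

variable {E : Type*} [AddCommGroup E] [Module ℝ E] [TopologicalSpace E]
  {F : Type*} [AddCommGroup F] [Module ℂ F] [TopologicalSpace F]
  [IsTopologicalAddGroup F] [ContinuousSMul ℂ F]
  {G : Type*} [Group G]
  {S : Type*} [Semigroup S] [StarMul S] [TopologicalSpace S] [ChartedSpace F S]
  {α : AbsVal S}

open HostCStar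

/-- A representation of `C^*(S, α)` is determined, on the elements of `S` that extend the one-parameter
group `t ↦ η(exp(t x))` to the upper half plane, by the unitary representation of `G`: matrix
coefficients of these elements are holomorphic functions with boundary values given by `G`. -/
lemma rep_eq_on_halfPlane (hα : α.IsLocallyBounded) {η : G →* unitary (Multiplier S)}
    {γ : G →* unitary 𝓜(ℂ, HostCStar F α)}
    (hγ : ∀ g s, (γ g : 𝓜(ℂ, HostCStar F α)).fst (eta F α s) =
      eta F α ((η g : Multiplier S).left s))
    {τ : ℝ → G} {ηx : ClosedHalfPlane → Multiplier S} {c : UpperHalfPlane → S}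
    (hc : IsHalfPlaneExtension F (fun t => η (τ t)) ηx c)
    {H : Type*} [NormedAddCommGroup H] [InnerProductSpace ℂ H] [CompleteSpace H]
    {π₁ π₂ : HostCStar F α →⋆ₙₐ[ℂ] (H →L[ℂ] H)}
    {ρ₁ ρ₂ : 𝓜(ℂ, HostCStar F α) →⋆ₐ[ℂ] (H →L[ℂ] H)}
    (hπ₁ : IsNondegenerate π₁) (hπ₂ : IsNondegenerate π₂)
    (hρ₁ : IsMultiplierExtension π₁ ρ₁) (hρ₂ : IsMultiplierExtension π₂ ρ₂)
    (hρ : ∀ g : G, ρ₁ (γ g : 𝓜(ℂ, HostCStar F α)) = ρ₂ (γ g : 𝓜(ℂ, HostCStar F α)))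
    (z : UpperHalfPlane) : π₁ (eta F α (c z)) = π₂ (eta F α (c z)) := by
  have heta : Continuous (eta F α) := (holomorphicMap_eta hα).1
  have key : ∀ s t v w, ⟪π₂ (eta F α t) w, π₁ (eta F α (c z)) (π₁ (eta F α s) v)⟫_ℂ =
      ⟪π₂ (eta F α t) w, π₂ (eta F α (c z)) (π₁ (eta F α s) v)⟫_ℂ := by
    intro s t v w
    set v' := π₁ (eta F α s) v with hv'
    set w' := π₂ (eta F α t) w with hw'
    -- in the second term the adjoint of `ηx p` acts on `t`, which makes sense up to the boundary
    let K : ClosedHalfPlane → ℂ := fun p => ⟪w', π₁ (eta F α ((ηx p).left s)) v⟫_ℂ -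
      ⟪π₂ (eta F α ((ηx p.invol).left t)) w, v'⟫_ℂ
    have hKc : Continuous K := by
      have h1 : Continuous fun p => (ηx p).left s :=
        hc.continuous_action.comp (continuous_id.prodMk continuous_const)
      have h2 : Continuous fun p : ClosedHalfPlane => (ηx p.invol).left t :=
        hc.continuous_action.comp
          (ClosedHalfPlane.continuous_invol.prodMk continuous_const)
      exact (continuous_const.inner (((rep_continuous π₁).comp (heta.comp h1)).clm_apply
        continuous_const)).sub ((((rep_continuous π₂).comp (heta.comp h2)).clm_apply
          continuous_const).inner continuous_const)
    have hKopen : ∀ z : UpperHalfPlane, K (ClosedHalfPlane.ofOpen z) =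
        ⟪w', π₁ (eta F α (c z)) v'⟫_ℂ - ⟪w', π₂ (eta F α (c z)) v'⟫_ℂ := by
      intro z
      have h1 : (ηx (ClosedHalfPlane.ofOpen z)).left s = c z * s := by rw [hc.map_open]; rfl
      have h2 : (ηx (ClosedHalfPlane.ofOpen z).invol).left t = star (c z) * t := by
        rw [hc.map_invol, hc.map_open, Multiplier.star_left]
        change star (star t * c z) = _
        rw [star_mul, star_star]
      simp only [K]
      rw [h1, h2, eta_mul, eta_mul, eta_star, map_mul, map_mul, ContinuousLinearMap.mul_def,
        ContinuousLinearMap.mul_def, ContinuousLinearMap.comp_apply,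
        ContinuousLinearMap.comp_apply, rep_star_inner π₂ (star _), star_star]
    have hKreal : ∀ t : ℝ, K (ClosedHalfPlane.ofReal t) = 0 := by
      intro r
      have h1 : (ηx (ClosedHalfPlane.ofReal r)).left s = (η (τ r) : Multiplier S).left s := by
        rw [hc.map_real]
      have h2 : (ηx (ClosedHalfPlane.ofReal r).invol).left t =
          (η (τ r)⁻¹ : Multiplier S).left t := by
        rw [hc.map_invol, hc.map_real, map_inv, ← Unitary.star_eq_inv, Unitary.coe_star]
      simp only [K]
      rw [h1, h2, ← hγ, ← hγ, ← hρ₁.apply_apply, ← hρ₂.apply_apply, map_inv,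
        ← Unitary.star_eq_inv, Unitary.coe_star, map_star, ContinuousLinearMap.star_eq_adjoint,
        ContinuousLinearMap.adjoint_inner_left, hρ, sub_self]
    let k : ℂ → ℂ := fun z => if h : 0 ≤ z.im then K ⟨z, h⟩ else 0
    have hk : ∀ p : ClosedHalfPlane, k p.1 = K p := fun p => dif_pos p.2
    let L : HostCStar F α →L[ℂ] ℂ :=
      (innerSL ℂ w').comp ((ContinuousLinearMap.apply ℂ H v').comp (repCLM π₁ - repCLM π₂))
    have hL : ∀ a, L a = ⟪w', π₁ a v'⟫_ℂ - ⟪w', π₂ a v'⟫_ℂ := fun a => inner_sub_right _ _ _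
    have hhol : HolomorphicMap ℂ ℂ (fun z => L (eta F α (c z))) :=
      ((holomorphicMap_eta hα).comp hc.holomorphic_open).linear_comp L
    have hkz := eq_zero_of_boundary_zero (k := k)
      (continuousOn_iff_continuous_domRestrict.2 (hKc.congr fun p => (hk p).symm))
      (fun z hz => hhol.differentiableAt_upperHalfPlane (fun z => by
        rw [hL, ← hKopen, ← hk]
        rfl) hz)
      (fun t => (hk (ClosedHalfPlane.ofReal t)).trans (hKreal t)) z.im_pos
    rw [← sub_eq_zero, ← hKopen, ← hk]
    exact hkz
  have hd₁ := hπ₁.dense_span (T := range (eta F α)) dense_span_eta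
  have hd₂ := hπ₂.dense_span (T := range (eta F α)) dense_span_eta
  refine ContinuousLinearMap.ext_on hd₁ ?_
  rintro _ ⟨_, ⟨s, rfl⟩, v, rfl⟩
  refine ext_inner_right ℂ fun u => ?_
  refine DFunLike.congr_fun (f := innerSL ℂ (π₁ (eta F α (c z)) (π₁ (eta F α s) v)))
    (g := innerSL ℂ (π₂ (eta F α (c z)) (π₁ (eta F α s) v))) (ContinuousLinearMap.ext_on hd₂ ?_) u
  rintro _ ⟨_, ⟨t, rfl⟩, w, rfl⟩
  rw [innerSL_apply_apply, innerSL_apply_apply, ← inner_conj_symm, key, inner_conj_symm]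

variable [TopologicalSpace G] [ChartedSpace E G]

/-- A representation of `C^*(S, α)` is determined by the unitary representation of `G`. -/
lemma IsHostSemigroup.rep_injective {expG : E → G} {η : G →* unitary (Multiplier S)}
    {W : ConvexCone ℝ E} (hS : IsHostSemigroup F expG η W) (hα : α.IsLocallyBounded)
    {γ : G →* unitary 𝓜(ℂ, HostCStar F α)}
    (hγ : ∀ g s, (γ g : 𝓜(ℂ, HostCStar F α)).fst (eta F α s) =
      eta F α ((η g : Multiplier S).left s))
    {H : Type*} [NormedAddCommGroup H] [InnerProductSpace ℂ H] [CompleteSpace H]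
    {π₁ π₂ : HostCStar F α →⋆ₙₐ[ℂ] (H →L[ℂ] H)}
    {ρ₁ ρ₂ : 𝓜(ℂ, HostCStar F α) →⋆ₐ[ℂ] (H →L[ℂ] H)}
    (hπ₁ : IsNondegenerate π₁) (hπ₂ : IsNondegenerate π₂)
    (hρ₁ : IsMultiplierExtension π₁ ρ₁) (hρ₂ : IsMultiplierExtension π₂ ρ₂)
    (hρ : ∀ g : G, ρ₁ (γ g : 𝓜(ℂ, HostCStar F α)) = ρ₂ (γ g : 𝓜(ℂ, HostCStar F α))) :
    π₁ = π₂ := by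
  have heq : ∀ s, π₁ (eta F α s) = π₂ (eta F α s) := by
    intro s
    refine ContinuousLinearMap.ext fun v => ext_inner_left ℂ fun w => ?_
    -- the difference of the matrix coefficients is a holomorphic function on `S`
    let L : HostCStar F α →L[ℂ] ℂ :=
      (innerSL ℂ w).comp ((ContinuousLinearMap.apply ℂ H v).comp (repCLM π₁ - repCLM π₂))
    have hL : ∀ a, L a = ⟪w, π₁ a v⟫_ℂ - ⟪w, π₂ a v⟫_ℂ := fun a => inner_sub_right _ _ _
    have h := hS.determining (fun s => L (eta F α s)) ((holomorphicMap_eta hα).linear_comp L)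
      fun x _ ηx c hc z => by
        rw [hL, rep_eq_on_halfPlane hα hγ hc hπ₁ hπ₂ hρ₁ hρ₂ hρ z, sub_self]
    exact sub_eq_zero.1 ((hL _).symm.trans (congrFun h s))
  ext1 a
  exact DFunLike.congr_fun (clm_ext (f := repCLM π₁) (g := repCLM π₂) heq) a

/-- The elements `η_α(s)` are smooth vectors, since the action of `G` on `S` is smooth and `η_α` is
holomorphic. -/
lemma IsHostSemigroup.isSmoothVector_eta [IsTopologicalAddGroup E] [ContinuousSMul ℝ E]
    [IsLCLieGroup E G] {expG : E → G} {η : G →* unitary (Multiplier S)}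
    {W : ConvexCone ℝ E} (hS : IsHostSemigroup F expG η W) (hα : α.IsLocallyBounded)
    {γ : G →* unitary 𝓜(ℂ, HostCStar F α)}
    (hγ : ∀ g s, (γ g : 𝓜(ℂ, HostCStar F α)).fst (eta F α s) =
      eta F α ((η g : Multiplier S).left s)) (s : S) :
    IsSmoothVector E γ (eta F α s) := by
  have := continuousSMul_real_of_complex F
  have hfst : ∀ s, SmoothMap E (HostCStar F α)
      (fun g : G => (γ g : 𝓜(ℂ, HostCStar F α)).fst (eta F α s)) := by
    intro s
    simp only [hγ]
    exact (holomorphicMap_eta hα).smoothMap.comp (hS.smooth_action.partial_left s)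
  refine ⟨hfst s, ?_⟩
  have h1 := ((hfst (star s)).comp (IsLCLieGroup.smooth_inv (E := E) (G := G))).linear_comp
    ((starL' ℝ : HostCStar F α ≃L[ℝ] HostCStar F α) : HostCStar F α →L[ℝ] HostCStar F α)
  have h2 : (fun g : G => (γ g : 𝓜(ℂ, HostCStar F α)).snd (eta F α s)) =
      fun g => star ((γ g⁻¹ : 𝓜(ℂ, HostCStar F α)).fst (eta F α (star s))) := by
    funext g
    rw [map_inv, ← Unitary.star_eq_inv, Unitary.coe_star, DoubleCentralizer.star_fst, star_star,
      eta_star, star_star]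
  rw [h2]
  exact h1

lemma IsSmoothVector.of_mem_span {A : Type*} [NonUnitalCStarAlgebra A] {γ : G →* unitary 𝓜(ℂ, A)}
    {T : Set A} (hT : ∀ a ∈ T, IsSmoothVector E γ a) {a : A} (ha : a ∈ Submodule.span ℂ T) :
    IsSmoothVector E γ a := by
  induction ha using Submodule.span_induction with
  | mem a ha => exact hT a ha
  | zero =>
    constructor <;>
    · simp only [map_zero]
      exact smoothMap_zero
  | add a b _ _ ha hb =>
    constructor
    · simp only [map_add]
      exact ha.1.add hb.1
    · simp only [map_add]
      exact ha.2.add hb.2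
  | smul c a _ ha =>
    let L : A →L[ℝ] A := (c • ContinuousLinearMap.id ℂ A).restrictScalars ℝ
    constructor
    · simp only [map_smul]
      exact ha.1.linear_comp L
    · simp only [map_smul]
      exact ha.2.linear_comp L

end Host

end HostAlg

theorem mainTheorem2
    {E : Type*} [AddCommGroup E] [Module ℝ E] [TopologicalSpace E] [IsTopologicalAddGroup E]
    [ContinuousSMul ℝ E] [LocallyConvexSpace ℝ E] [T2Space E]
    {F : Type*} [AddCommGroup F] [Module ℂ F] [TopologicalSpace F] [IsTopologicalAddGroup F]
    [ContinuousSMul ℂ F] [LocallyConvexSpace ℝ F] [T2Space F]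
    {G : Type*} [Group G] [TopologicalSpace G] [ChartedSpace E G] [T2Space G] [ConnectedSpace G]
    [HostAlg.IsLCLieGroup E G]
    {S : Type*} [Semigroup S] [StarMul S] [TopologicalSpace S] [ChartedSpace F S] [T2Space S]
    [HostAlg.IsComplexInvolutiveSemigroup F S]
    (expG : E → G) (hexp : HostAlg.IsExpFunction expG)
    (η : G →* unitary (HostAlg.Multiplier S)) (W : ConvexCone ℝ E)
    (hS : HostAlg.IsHostSemigroup F expG η W)
    (α : HostAlg.AbsVal S) (hα : α.IsLocallyBounded)
    (hinv : ∀ (g : G) (s : S), α ((η g : HostAlg.Multiplier S).left s) = α s) :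
    ∃ γ : G →* unitary 𝓜(ℂ, HostAlg.HostCStar F α),
      (∀ (g : G) (s : S), (γ g : 𝓜(ℂ, HostAlg.HostCStar F α)).fst (HostAlg.HostCStar.eta F α s) =
        HostAlg.HostCStar.eta F α ((η g : HostAlg.Multiplier S).left s)) ∧
      (∀ γ' : G →* unitary 𝓜(ℂ, HostAlg.HostCStar F α),
        (∀ (g : G) (s : S),
          (γ' g : 𝓜(ℂ, HostAlg.HostCStar F α)).fst (HostAlg.HostCStar.eta F α s) =
            HostAlg.HostCStar.eta F α ((η g : HostAlg.Multiplier S).left s)) → γ' = γ) ∧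
      HostAlg.IsStrictlySmooth E γ ∧
      HostAlg.IsHostAlgebra γ := by
  let γ : G →* unitary 𝓜(ℂ, HostAlg.HostCStar F α) := (HostAlg.HostCStar.unitaryHom F α).comp η
  have hγ : ∀ (g : G) (s : S),
      (γ g : 𝓜(ℂ, HostAlg.HostCStar F α)).fst (HostAlg.HostCStar.eta F α s) =
        HostAlg.HostCStar.eta F α ((η g : HostAlg.Multiplier S).left s) :=
    fun g s => HostAlg.HostCStar.toMultiplier_fst_eta (η g) s
  have hsmooth := hS.isSmoothVector_eta hα hγ
  refine ⟨γ, hγ, fun γ' hγ' => ?_, ?_, ?_, ?_⟩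
  · ext1 g
    exact Subtype.ext (HostAlg.HostCStar.multiplier_ext fun s => by rw [hγ', hγ])
  · refine HostAlg.HostCStar.dense_span_eta.mono fun a ha =>
      HostAlg.IsSmoothVector.of_mem_span ?_ ha
    rintro _ ⟨s, rfl⟩
    exact hsmooth s
  · intro H _ _ _ π hπ
    refine ⟨hπ.exists_extension, fun ρ hρ v =>
      hπ.continuous_extension hρ γ HostAlg.HostCStar.dense_span_eta ?_ v⟩
    rintro _ ⟨s, rfl⟩
    exact (hsmooth s).1.1
  · intro H _ _ _ π₁ π₂ ρ₁ ρ₂ hπ₁ hπ₂ hρ₁ hρ₂ hρ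
    exact hS.rep_injective hα hγ hπ₁ hπ₂ hρ₁ hρ₂ hρ
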